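/- Setting. Let $M$ be a compact smooth manifold without boundary, of finite dimension. Let $d_M$ be the distance on $M$ given by some smooth Riemannian metric, assumed finite (so $M$ is connected), and let $m$ be the normalized ($m(M)=1$) Riemannian volume of some smooth Riemannian metric on $M$. Let $n\ge 1$, let $B^n$ be the open Euclidean unit ball of $\mathbb R^n$, and let $f:M\times B^n\to M$ be a $C^1$ map such that $f_t=f(\cdot,t)$ is a $C^1$ diffeomorphism of $M$ for every $t\in B^n$. Fix $a\in B^n$ and $\varepsilon>0$ such that the closed ball $T=\{t:\|t-a\|_2\le\varepsilon\}$ is contained in $B^n$. Let $\nu$ be the normalized Lebesgue measure on $T$, let $\Delta=T^{\mathbb N}$ be the space of sequences $\underline t=(t_1,t_2,\ldots)$ in $T$, with the product measure $\nu^\infty$, and put $$f^0(z,\underline t)=z,\qquad f^k(z,\underline t)=f_{t_k}\circ\cdots\circ f_{t_1}(z)\quad(k\ge1),\qquad S(z,\underline t)=\bigl(f_{t_1}(z),(t_2,t_3,\ldots)\bigr)$$ for $(z,\underline t)\in M\times\Delta$, and $f^k(U,\Delta)=\{f^k(z,\underline t): z\in U,\ \underline t\in\Delta\}$ for $U\subseteq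 M$. Assume that there are $K\in\mathbb N$ and $\xi_0>0$ such that for all $k\ge K$ and all $x\in M$: A) $f^k(x,\Delta)\supseteq B(f_a^k(x),\xi_0)$, where $B(y,\xi_0)$ is the open $d_M$-ball of radius $\xi_0$ around $y$; B) the push-forward of $\nu^\infty$ under $f^k(x,\cdot)$ is absolutely continuous with respect to $m$. Definitions. An *s-invariant domain* of period $r\ge1$ is a finite sequence $D=(U_0,\ldots,U_{r-1})$ of nonempty open subsets of $M$ with pairwise disjoint closures such that $f^k(U_i,\Delta)\subseteq U_{(k+i)\bmod r}$ for all $k\ge1$ and all $i$; its closure is $\overline D=\overline{U_0}\cup\cdots\cup\overline{U_{r-1}}$. Let $D=(U_0,\ldots,U_{r-1})$ and $D'=(U'_0,\ldots,U'_{r'-1})$ be s-invariant domains. They are regarded as equal if there are $i,i'\in\mathbb N$ with $U_{(i+k)\bmod r}=U'_{(i'+k)\bmod r'}$ for all $k\ge1$. We write $D\prec D'$ if there are $i,i'\in\mathbb N$ with $U_{i\bmod r}\subsetneq U'_{i'\bmod r'}$ and $U_{(i+k)\bmod r}\subseteq U'_{(i'+k)\bmod r'}$ for all $k\ge1$, and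 $D\preceq D'$ if $D=D'$ or $D\prec D'$. An s-invariant domain is *minimal* if it is minimal for $\preceq$. A Borel probability measure $\mu$ on $M$ is *stationary* if $\mu\times\nu^\infty$ is $S$-invariant, and *stationary ergodic* if moreover $\mu\times\nu^\infty$ is $S$-ergodic. The *ergodic basin* $E(\mu)$ of a stationary ergodic $\mu$ is the set of $x\in M$ such that, for $\nu^\infty$-a.e. $\underline t\in\Delta$, $$\lim_{N\to\infty}\frac1N\sum_{j=0}^{N-1}\varphi\bigl(f^j(x,\underline t)\bigr)=\int\varphi\,d\mu\qquad\text{for every continuous }\varphi:M\to\mathbb R.$$ A stationary ergodic probability measure $\mu$ is *physical* if $m(E(\mu))>0$. Proposition. For every minimal s-invariant domain $\mathcal M$ there is exactly one physical probability measure $\mu$ that is absolutely continuous with respect to $m$ and has support contained in $\overline{\mathcal M}$. Moreover, every $x\in\overline{\mathcal M}$ belongs to the ergodic basin $E(\mu)$ of this measure (the characteristic measure of $\mathcal M$). -/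

import Mathlib

open Set Filter Topology MeasureTheory
open scoped Manifold ContDiff ENNReal NNReal

noncomputable section

namespace RandomPerturbation

/-- The parameter space `ℝⁿ` with the Euclidean norm (also used as model space of manifolds). -/
abbrev Euc (n : ℕ) : Type := EuclideanSpace ℝ (Fin n)

section Riemannian

variable {d : ℕ} {M : Type*}

/-- Smooth Riemannian metrics on the (boundaryless) manifold `M` of dimension `d`. -/
abbrev RiemMetric (d : ℕ) (M : Type*) [TopologicalSpace M] [ChartedSpace (Euc d) M]
    [IsManifold 𝓘(ℝ, Euc d) ∞ M] :=
  Bundle.ContMDiffRiemannianMetric 𝓘(ℝ, Euc d) ∞ (Euc d)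
    (fun x : M ↦ TangentSpace 𝓘(ℝ, Euc d) x)

/-- The distance of `M` is the Riemannian distance of `g`: the infimum of the `g`-lengths of
`C¹` paths. -/
def IsRiemannianDistance [MetricSpace M] [ChartedSpace (Euc d) M]
    [IsManifold 𝓘(ℝ, Euc d) ∞ M] (g : RiemMetric d M) : Prop :=
  letI : Bundle.RiemannianBundle (fun x : M ↦ TangentSpace 𝓘(ℝ, Euc d) x) :=
    ⟨g.toRiemannianMetric⟩
  IsRiemannianManifold 𝓘(ℝ, Euc d) M

variable [TopologicalSpace M] [ChartedSpace (Euc d) M] [IsManifold 𝓘(ℝ, Euc d) ∞ M]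

/-- The coordinate vector field `∂/∂yᵢ` of the chart `e`, at the point of coordinates `y`. -/
def coordVector (e : OpenPartialHomeomorph M (Euc d)) (y : Euc d) (i : Fin d) :
    TangentSpace 𝓘(ℝ, Euc d) (e.symm y) :=
  mfderiv 𝓘(ℝ, Euc d) 𝓘(ℝ, Euc d) e.symm y (EuclideanSpace.single i (1 : ℝ) : Euc d)

/-- The matrix `(g_ij)` of the metric `g` in the chart `e`, at the point of coordinates `y`. -/
def gramMatrix (g : RiemMetric d M) (e : OpenPartialHomeomorph M (Euc d)) (y : Euc d) :
    Matrix (Fin d) (Fin d) ℝ :=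
  Matrix.of fun i j ↦ g.inner (e.symm y) (coordVector e y i) (coordVector e y j)

/-- `m` is the normalized Riemannian volume of `g`: it is a probability measure and, for some
normalizing constant `c`, it is given in every chart by `c · √det (g_ij) dy`. -/
structure IsNormalizedRiemannianVolume [MeasurableSpace M] (g : RiemMetric d M)
    (m : Measure M) : Prop where
  isProbabilityMeasure : IsProbabilityMeasure m
  exists_const : ∃ c : ℝ≥0, ∀ e ∈ atlas (Euc d) M, ∀ s : Set M, MeasurableSet s → s ⊆ e.source →
    m s = c * ∫⁻ y in e '' s, ENNReal.ofReal (√(gramMatrix g e y).det)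

end Riemannian

/-- Parametric noise of level `ε` around `f_a`, for a `C¹` family `f : M × Bⁿ → M` of
diffeomorphisms of `M` parametrized by the open unit ball `Bⁿ` of `ℝⁿ`, with
`closedBall a ε ⊆ Bⁿ`. (The values of `f` at parameters outside `Bⁿ` are irrelevant.) -/
structure ParametricNoise (d n : ℕ) (M : Type*) [TopologicalSpace M] [ChartedSpace (Euc d) M] where
  f : M → Euc n → M
  contMDiffOn : ContMDiffOn (𝓘(ℝ, Euc d).prod 𝓘(ℝ, Euc n)) 𝓘(ℝ, Euc d) 1
    (fun p : M × Euc n ↦ f p.1 p.2) (univ ×ˢ Metric.ball 0 1)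
  diffeo : ∀ t ∈ Metric.ball (0 : Euc n) 1,
    ∃ φ : Diffeomorph 𝓘(ℝ, Euc d) 𝓘(ℝ, Euc d) M M 1, ∀ x, φ x = f x t
  a : Euc n
  ε : ℝ
  ε_pos : 0 < ε
  closedBall_subset : Metric.closedBall a ε ⊆ Metric.ball 0 1

namespace ParametricNoise

variable {d n : ℕ} {M : Type*}

section Topological

variable [TopologicalSpace M] [ChartedSpace (Euc d) M] (F : ParametricNoise d n M)

/-- The space `T` of parameters, the closed ball of radius `ε` around `a`. -/
abbrev T : Type := Metric.closedBall F.a F.ε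

/-- The perturbation space `Δ = T^ℕ`; the entry `t k` is the parameter of the step `k + 1`. -/
abbrev Δ : Type := ℕ → F.T

/-- The normalized Lebesgue measure on `T`. -/
def ν : Measure F.T :=
  (volume (Metric.closedBall F.a F.ε))⁻¹ • Measure.comap Subtype.val (volume : Measure (Euc n))

instance isProbabilityMeasure_ν : IsProbabilityMeasure F.ν := by
  constructor
  rw [ν, Measure.smul_apply, comap_subtype_coe_apply Metric.isClosed_closedBall.measurableSet]
  simp only [image_univ, Subtype.range_coe_subtype, ofPred_mem_eq, smul_eq_mul]
  exact ENNReal.inv_mul_cancel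
    (Metric.measure_closedBall_pos volume F.a F.ε_pos).ne'
    (isCompact_closedBall F.a F.ε).measure_lt_top.ne

/-- The product measure `ν^∞` on `Δ`. -/
def νInf : Measure F.Δ := Measure.infinitePi fun _ : ℕ ↦ F.ν

/-- The perturbed iterates, `f^k(z, t) = f_{t_k} ∘ ⋯ ∘ f_{t_1} (z)`. -/
def iter : ℕ → M → F.Δ → M
  | 0, z, _ => z
  | k + 1, z, t => F.f (iter k z t) (t k)

/-- The skew product `S (z, t) = (f_{t_1}(z), σ t)` on `M × Δ`, with `σ` the left shift. -/
def S (p : M × F.Δ) : M × F.Δ := (F.f p.1 (p.2 0), fun k ↦ p.2 (k + 1))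

/-- The set `f^k(U, Δ)`. -/
def imageΔ (k : ℕ) (U : Set M) : Set M := {y | ∃ z ∈ U, ∃ t : F.Δ, F.iter k z t = y}

/-- A symmetrically invariant domain `(U_0, …, U_{r-1})`: finitely many nonempty open sets with
pairwise disjoint closures such that `f^k(U_i, Δ) ⊆ U_{(k+i) mod r}` for all `k ≥ 1` and all `i`. -/
structure SInvariantDomain where
  r : ℕ
  r_pos : 0 < r
  U : Fin r → Set M
  isOpen : ∀ i, IsOpen (U i)
  nonempty : ∀ i, (U i).Nonempty
  separated : ∀ i j, i ≠ j → Disjoint (closure (U i)) (closure (U j))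
  invariant : ∀ (i : Fin r) (k : ℕ), 1 ≤ k →
    F.imageΔ k (U i) ⊆ U ⟨(k + i) % r, Nat.mod_lt _ r_pos⟩

namespace SInvariantDomain

variable {F}

/-- `D.cyc i` is `U_{i mod r}`. -/
def cyc (D : F.SInvariantDomain) (i : ℕ) : Set M := D.U ⟨i % D.r, Nat.mod_lt _ D.r_pos⟩

/-- Equality of s-invariant domains (up to a cyclic renumbering). -/
def Same (D D' : F.SInvariantDomain) : Prop :=
  ∃ i i' : ℕ, ∀ k : ℕ, 1 ≤ k → D.cyc (i + k) = D'.cyc (i' + k)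

/-- The strict order `D ≺ D'` between s-invariant domains. -/
def Prec (D D' : F.SInvariantDomain) : Prop :=
  ∃ i i' : ℕ, D.cyc i ⊆ D'.cyc i' ∧ D.cyc i ≠ D'.cyc i' ∧
    ∀ k : ℕ, 1 ≤ k → D.cyc (i + k) ⊆ D'.cyc (i' + k)

/-- The order `D ⪯ D'` between s-invariant domains. -/
def PrecEq (D D' : F.SInvariantDomain) : Prop := D.Same D' ∨ D.Prec D'

/-- Minimal invariant domains. -/
def IsMinimal (D : F.SInvariantDomain) : Prop :=
  ∀ D' : F.SInvariantDomain, D'.PrecEq D → D'.Same D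

/-- The closure of `D`, the union of the closures of the `U_i`. -/
def closed (D : F.SInvariantDomain) : Set M := ⋃ i, closure (D.U i)

end SInvariantDomain

variable [MeasurableSpace M]

/-- Stationary probability measures: `μ × ν^∞` is `S`-invariant. -/
structure IsStationary (μ : Measure M) : Prop where
  isProbabilityMeasure : IsProbabilityMeasure μ
  measurePreserving : MeasurePreserving F.S (μ.prod F.νInf) (μ.prod F.νInf)

/-- Stationary ergodic probability measures: moreover `μ × ν^∞` is `S`-ergodic. -/
structure IsStationaryErgodic (μ : Measure M) : Prop extends F.IsStationary μ where
  ergodic : Ergodic F.S (μ.prod F.νInf)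

/-- The set of `μ`-generic points. For a stationary ergodic `μ` this is the ergodic basin. -/
def basin (μ : Measure M) : Set M :=
  {x | ∀ᵐ t ∂F.νInf, ∀ φ : C(M, ℝ),
    Tendsto (fun N : ℕ ↦ (N : ℝ)⁻¹ * ∑ j ∈ Finset.range N, φ (F.iter j x t)) atTop
      (𝓝 (∫ x, φ x ∂μ))}

/-- Physical measures: stationary ergodic probability measures whose ergodic basin has positive
volume, for the reference volume `m`. -/
structure IsPhysical (m μ : Measure M) : Prop extends F.IsStationaryErgodic μ where
  basin_pos : 0 < m (F.basin μ)

end Topological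

/-- Condition `A)`: for all `k ≥ K` and all `x`, the set `f^k(x, Δ)` contains the ball of radius
`ξ₀` around the unperturbed iterate `f_a^k(x)`. -/
def ConditionA [MetricSpace M] [ChartedSpace (Euc d) M] (F : ParametricNoise d n M)
    (K : ℕ) (ξ₀ : ℝ) : Prop :=
  ∀ k ≥ K, ∀ x : M, Metric.ball ((fun y ↦ F.f y F.a)^[k] x) ξ₀ ⊆ F.imageΔ k {x}

/-- Condition `B)`: for all `k ≥ K` and all `x`, the distribution `f^k(x, ν^∞)` of the `k`-th
perturbed iterate of `x` is absolutely continuous with respect to `m`. -/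
def ConditionB [TopologicalSpace M] [ChartedSpace (Euc d) M] [MeasurableSpace M]
    (F : ParametricNoise d n M) (m : Measure M) (K : ℕ) : Prop :=
  ∀ k ≥ K, ∀ x : M, F.νInf.map (F.iter k x) ≪ m

end ParametricNoise

end RandomPerturbation

end

/-! The heart of the matter is that the closure of a minimal domain carries at most one stationary
probability measure (`eq_of_push_eq`). Removing their common part from two different ones leaves
nonzero, mutually singular stationary measures `ρ₁` and `ρ₂`. Some almost surely forward invariant
set `E` is then full for `ρ₁` and null for `ρ₂`. By condition B both are absolutely continuous, so
`E` has a Lebesgue density point `x` in the closure. Condition A covers a ball with points reached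
from `x`, but the law of the chain may be degenerate there, so invariance of `E` does not by itself
make the ball lie in `E` up to a null set. Instead, density points are propagated: every map of the
family sends density points of `E` to density points (`hasFullDensityAt_step`). So `E` fills the
ball up to a null set and `ρ₂` vanishes on it. This is impossible, since by condition A and
minimality the support of `ρ₂` contains the whole closure (`closed_subset_support`).

The rest follows from uniqueness. A strong law for the martingale `mart`, proved from exponential
moments, makes every limit of empirical measures stationary. Compactness then gives existence, and
uniqueness forces convergence from every starting point of the closure, hence the basin claim. For
ergodicity, the conditional probability of an `S`-invariant event given the starting point is
harmonic. Uniqueness makes it almost everywhere constant, and a zero-one argument on cylinders shows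
that the constant is 0 or 1. -/

noncomputable section

namespace RandomPerturbation.ParametricNoise

/-! ### The shift structure of the noise, and the one-step map -/

section Chain

variable {d n : ℕ} {M : Type*} [TopologicalSpace M] [ChartedSpace (Euc d) M]
  (F : ParametricNoise d n M)

/-- Prepend a parameter to a sequence of parameters. -/
def cons (p : F.T × F.Δ) : F.Δ
  | 0 => p.1
  | k + 1 => p.2 k

@[simp] lemma cons_zero (p : F.T × F.Δ) : F.cons p 0 = p.1 := rfl

@[simp] lemma cons_succ (p : F.T × F.Δ) (k : ℕ) : F.cons p (k + 1) = p.2 k := rfl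

lemma measurable_cons : Measurable F.cons := by
  refine measurable_pi_lambda _ fun k ↦ ?_
  cases k with
  | zero => exact measurable_fst
  | succ k => exact (measurable_pi_apply k).comp measurable_snd

instance : IsProbabilityMeasure F.νInf := by unfold νInf; infer_instance

/-- This allows conditioning on the first parameter, the source of all later inductions on the
number of steps. It suffices to compare cylinders. -/
lemma map_cons : (F.ν.prod F.νInf).map F.cons = F.νInf := by
  refine Measure.eq_infinitePi _ fun s A hA ↦ ?_
  classical
  rw [Measure.map_apply F.measurable_cons (.pi s.countable_toSet fun i _ ↦ hA i)]
  set s' : Finset ℕ := (s.erase 0).image Nat.pred with hs'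
  have hmem : ∀ k, k ∈ s' ↔ k + 1 ∈ s := by
    intro k
    simp only [hs', Finset.mem_image, Finset.mem_erase]
    constructor
    · rintro ⟨a, ⟨h0, ha⟩, rfl⟩
      rwa [Nat.pred_eq_sub_one, Nat.sub_add_cancel (Nat.pos_of_ne_zero h0)]
    · exact fun h ↦ ⟨k + 1, ⟨by omega, h⟩, rfl⟩
  have hpre : F.cons ⁻¹' (Set.pi s A) =
      (if 0 ∈ s then A 0 else univ) ×ˢ Set.pi s' fun k ↦ A (k + 1) := by
    ext ⟨u, t⟩
    simp only [mem_preimage, Set.mem_pi, mem_prod, Finset.mem_coe, hmem]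
    constructor
    · intro h
      refine ⟨?_, fun k hk ↦ h (k + 1) hk⟩
      split_ifs with h0
      · exact h 0 h0
      · trivial
    · rintro ⟨h0, h⟩ (_ | k) hk
      · simpa [hk] using h0
      · exact h k hk
  have hprod : ∏ k ∈ s', F.ν (A (k + 1)) = ∏ i ∈ s.erase 0, F.ν (A i) := by
    rw [hs', Finset.prod_image]
    · refine Finset.prod_congr rfl fun i hi ↦ ?_
      have : i ≠ 0 := (Finset.mem_erase.1 hi).1
      rw [Nat.pred_eq_sub_one, Nat.sub_add_cancel (Nat.pos_of_ne_zero this)]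
    · intro i hi j hj h
      have hi : i ≠ 0 := (Finset.mem_erase.1 hi).1
      have hj : j ≠ 0 := (Finset.mem_erase.1 hj).1
      simp only [Nat.pred_eq_sub_one] at h
      omega
  rw [hpre, Measure.prod_prod, νInf, Measure.infinitePi_pi _ fun i _ ↦ hA _, hprod]
  split_ifs with h0
  · exact Finset.mul_prod_erase s (fun i ↦ F.ν (A i)) h0
  · rw [measure_univ, one_mul, Finset.erase_eq_of_notMem h0]

lemma lintegral_νInf {h : F.Δ → ℝ≥0∞} (hh : Measurable h) :
    ∫⁻ t, h t ∂F.νInf = ∫⁻ u, ∫⁻ t, h (F.cons (u, t)) ∂F.νInf ∂F.ν := by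
  conv_lhs => rw [← F.map_cons]
  rw [lintegral_map hh F.measurable_cons]
  exact lintegral_prod _ (hh.comp F.measurable_cons).aemeasurable

lemma νInf_apply {C : Set F.Δ} (hC : MeasurableSet C) :
    F.νInf C = ∫⁻ u, F.νInf {t | F.cons (u, t) ∈ C} ∂F.ν := by
  conv_lhs => rw [← F.map_cons]
  rw [Measure.map_apply F.measurable_cons hC, Measure.prod_apply (F.measurable_cons hC)]
  rfl

lemma iter_succ_cons (k : ℕ) (x : M) (u : F.T) (t : F.Δ) :
    F.iter (k + 1) x (F.cons (u, t)) = F.iter k (F.f x u) t := by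
  induction k with
  | zero => rfl
  | succ k ih => rw [iter, ih]; rfl

/-- The one-step map `(x, t) ↦ f_t(x)` on `M × T`. -/
def step (p : M × F.T) : M := F.f p.1 p.2

lemma continuous_step : Continuous F.step := by
  have h := F.contMDiffOn.continuousOn
  have : Continuous fun p : M × F.T ↦ ((p.1, (p.2 : Euc n)) : M × Euc n) := by fun_prop
  exact h.comp_continuous this fun p ↦ ⟨trivial, F.closedBall_subset p.2.2⟩

lemma continuous_iter (k : ℕ) : Continuous fun p : M × F.Δ ↦ F.iter k p.1 p.2 := by
  induction k with
  | zero => exact continuous_fst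
  | succ k ih =>
    exact F.continuous_step.comp (ih.prodMk ((continuous_apply k).comp continuous_snd))

lemma iter_mem_of_forall_step_mem {V : Set M} (hV : ∀ x ∈ V, ∀ u : F.T, F.f x u ∈ V)
    (k : ℕ) {x : M} (hx : x ∈ V) (t : F.Δ) : F.iter k x t ∈ V := by
  induction k with
  | zero => exact hx
  | succ k ih => exact hV _ ih _

lemma step_homeomorph (u : F.T) : ∃ φ : M ≃ₜ M, ∀ x, φ x = F.f x u := by
  obtain ⟨φ, hφ⟩ := F.diffeo u (F.closedBall_subset u.2)
  exact ⟨φ.toHomeomorph, hφ⟩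

/-- The open ball is dense in `T`, so a nonempty relatively open set contains a nonempty open set of
the ambient space. -/
lemma ν_pos_of_isOpen {V : Set F.T} (hV : IsOpen V) (hne : V.Nonempty) : 0 < F.ν V := by
  obtain ⟨W, hW, rfl⟩ := isOpen_induced_iff.1 hV
  obtain ⟨u, hu⟩ := hne
  have hcl : (u : Euc n) ∈ closure (Metric.ball F.a F.ε) := by
    rw [closure_ball _ F.ε_pos.ne']; exact u.2
  obtain ⟨v, hvW, hv⟩ := mem_closure_iff.1 hcl W hW hu
  rw [ν, Measure.smul_apply, smul_eq_mul,
    comap_subtype_coe_apply Metric.isClosed_closedBall.measurableSet]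
  refine ENNReal.mul_pos (ENNReal.inv_ne_zero.2 (isCompact_closedBall F.a F.ε).measure_lt_top.ne) ?_
  refine ((hW.inter Metric.isOpen_ball).measure_pos volume ⟨v, hvW, hv⟩).trans_le ?_ |>.ne'
  refine measure_mono ?_
  rintro w ⟨hwW, hw⟩
  exact ⟨⟨w, Metric.ball_subset_closedBall hw⟩, hwW, rfl⟩

instance : F.ν.IsOpenPosMeasure := ⟨fun _ hV hne ↦ (F.ν_pos_of_isOpen hV hne).ne'⟩

lemma integrable_of_continuous {h : F.T → ℝ} (hh : Continuous h) : Integrable h F.ν :=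
  hh.integrable_of_hasCompactSupport (HasCompactSupport.of_compactSpace _)

end Chain

/-! ### Stationary measures as fixed points of the transfer operator -/

section Stationary

variable {d n : ℕ} {M : Type*} [MetricSpace M] [ChartedSpace (Euc d) M]
  [MeasurableSpace M] [BorelSpace M] (F : ParametricNoise d n M)

lemma measurable_step : Measurable F.step := F.continuous_step.measurable

lemma measurable_iter (k : ℕ) : Measurable fun p : M × F.Δ ↦ F.iter k p.1 p.2 :=
  (F.continuous_iter k).measurable

/-- One step of the Markov chain, acting on measures. -/
def push (μ : Measure M) : Measure M := (μ.prod F.ν).map F.step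

lemma push_apply (μ : Measure M) [SFinite μ] {s : Set M} (hs : MeasurableSet s) :
    F.push μ s = ∫⁻ x, F.ν {u | F.f x u ∈ s} ∂μ := by
  rw [push, Measure.map_apply F.measurable_step hs, Measure.prod_apply (F.measurable_step hs)]
  rfl

lemma push_apply_univ (μ : Measure M) [SFinite μ] : F.push μ univ = μ univ := by
  simp [F.push_apply μ .univ]

instance (μ : Measure M) [IsFiniteMeasure μ] : IsFiniteMeasure (F.push μ) :=
  ⟨by rw [F.push_apply_univ]; exact measure_lt_top _ _⟩

lemma lintegral_push (μ : Measure M) [SFinite μ] {h : M → ℝ≥0∞} (hh : Measurable h) :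
    ∫⁻ x, h x ∂F.push μ = ∫⁻ x, ∫⁻ u, h (F.f x u) ∂F.ν ∂μ := by
  rw [push, lintegral_map hh F.measurable_step]
  exact lintegral_prod _ (hh.comp F.measurable_step).aemeasurable

lemma push_mono {μ μ' : Measure M} [SFinite μ] [SFinite μ'] (h : μ ≤ μ') :
    F.push μ ≤ F.push μ' := by
  refine Measure.le_iff.2 fun s hs ↦ ?_
  rw [F.push_apply _ hs, F.push_apply _ hs]
  exact lintegral_mono' h le_rfl

lemma push_add (μ μ' : Measure M) [SFinite μ] [SFinite μ'] :
    F.push (μ + μ') = F.push μ + F.push μ' := by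
  ext s hs
  rw [Measure.add_apply, F.push_apply _ hs, F.push_apply _ hs, F.push_apply _ hs,
    lintegral_add_measure]

lemma push_smul (c : ℝ≥0∞) (μ : Measure M) [SFinite μ] [SFinite (c • μ)] :
    F.push (c • μ) = c • F.push μ := by
  ext s hs
  rw [Measure.smul_apply, F.push_apply _ hs, F.push_apply _ hs, lintegral_smul_measure]

lemma measurable_S : Measurable F.S := by
  refine Measurable.prodMk ?_ ?_
  · exact F.measurable_step.comp
      (measurable_fst.prodMk ((measurable_pi_apply 0).comp measurable_snd))
  · exact measurable_pi_lambda _ fun k ↦ (measurable_pi_apply (k + 1)).comp measurable_snd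

/-- `S` consumes the first parameter to move the point and leaves a tail independent of it.
Invariance under `S` thus reduces to a fixed point equation on `M`. -/
lemma map_S_prod (μ : Measure M) [SFinite μ] :
    (μ.prod F.νInf).map F.S = (F.push μ).prod F.νInf := by
  have hS := F.measurable_S
  calc (μ.prod F.νInf).map F.S
      = ((μ.map id).prod ((F.ν.prod F.νInf).map F.cons)).map F.S := by
        rw [F.map_cons, Measure.map_id]
    _ = (μ.prod (F.ν.prod F.νInf)).map (F.S ∘ Prod.map id F.cons) := by
        rw [Measure.map_prod_map _ _ measurable_id F.measurable_cons,
          Measure.map_map hS (measurable_id.prodMap F.measurable_cons)]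
    _ = (((μ.prod F.ν).prod F.νInf).map MeasurableEquiv.prodAssoc).map
          (F.S ∘ Prod.map id F.cons) := by
        rw [Measure.prodAssoc_prod]
    _ = ((μ.prod F.ν).prod F.νInf).map (Prod.map F.step id) := by
        rw [Measure.map_map (hS.comp (measurable_id.prodMap F.measurable_cons))
          MeasurableEquiv.prodAssoc.measurable]
        rfl
    _ = (F.push μ).prod F.νInf := by
        rw [← Measure.map_prod_map _ _ F.measurable_step measurable_id, Measure.map_id, push]

lemma isStationary_iff {μ : Measure M} :
    F.IsStationary μ ↔ IsProbabilityMeasure μ ∧ F.push μ = μ := by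
  constructor
  · rintro ⟨h1, h2⟩
    refine ⟨h1, ?_⟩
    have := congrArg (Measure.map Prod.fst) ((F.map_S_prod μ).symm.trans h2.map_eq)
    simpa [Measure.map_fst_prod] using this
  · rintro ⟨h1, h2⟩
    exact ⟨h1, F.measurable_S, by rw [F.map_S_prod, h2]⟩

lemma step_mem_support {μ : Measure M} [IsFiniteMeasure μ] (hμ : F.push μ = μ) {x : M}
    (hx : x ∈ μ.support) (u : F.T) : F.f x u ∈ μ.support := by
  rw [Measure.mem_support_iff_forall] at hx ⊢
  intro V hV
  have hpre : F.step ⁻¹' V ∈ 𝓝 (x, u) := F.continuous_step.continuousAt hV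
  obtain ⟨A, hA, B, hB, hAB⟩ := mem_nhds_prod_iff.1 hpre
  have h1 : 0 < μ A * F.ν B :=
    ENNReal.mul_pos (hx A hA).ne' (Measure.measure_pos_of_mem_nhds _ hB).ne'
  rw [← Measure.prod_prod] at h1
  calc 0 < _ := h1
    _ ≤ (μ.prod F.ν) (F.step ⁻¹' V) := measure_mono hAB
    _ ≤ F.push μ V := Measure.le_map_apply F.measurable_step.aemeasurable _
    _ = μ V := by rw [hμ]

/-- One step preserves total mass, so a finite measure that decreases is fixed. -/
lemma push_eq_of_le {μ : Measure M} [IsFiniteMeasure μ] (h : F.push μ ≤ μ) : F.push μ = μ :=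
  Measure.eq_of_le_of_measure_univ_eq h (F.push_apply_univ μ)

lemma inf_push {μ₁ μ₂ : Measure M} [IsFiniteMeasure μ₁] [IsFiniteMeasure μ₂]
    (h₁ : F.push μ₁ = μ₁) (h₂ : F.push μ₂ = μ₂) : F.push (μ₁ ⊓ μ₂) = μ₁ ⊓ μ₂ := by
  have : IsFiniteMeasure (μ₁ ⊓ μ₂) := isFiniteMeasure_of_le μ₁ inf_le_left
  refine F.push_eq_of_le (le_inf ?_ ?_)
  · exact (F.push_mono inf_le_left).trans h₁.le
  · exact (F.push_mono inf_le_right).trans h₂.le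

lemma sub_push {μ κ : Measure M} [IsFiniteMeasure μ] (hle : κ ≤ μ)
    (h : F.push μ = μ) (hκ : F.push κ = κ) : F.push (μ - κ) = μ - κ := by
  have : IsFiniteMeasure κ := isFiniteMeasure_of_le μ hle
  have h1 : μ - κ + κ = μ := Measure.sub_add_cancel_of_le hle
  have h2 : F.push (μ - κ) + κ = μ - κ + κ := by
    calc F.push (μ - κ) + κ = F.push (μ - κ) + F.push κ := by rw [hκ]
      _ = μ - κ + κ := by rw [← F.push_add, h1, h]
  ext s hs
  have := congrArg (fun ρ : Measure M ↦ ρ s) h2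
  simp only [Measure.add_apply] at this
  exact (ENNReal.add_left_inj (measure_ne_top κ s)).1 this

/-- Two different stationary probability measures yield two nonzero mutually singular ones. -/
lemma exists_mutuallySingular {μ₁ μ₂ : Measure M} [IsProbabilityMeasure μ₁]
    [IsProbabilityMeasure μ₂] (h₁ : F.push μ₁ = μ₁) (h₂ : F.push μ₂ = μ₂) (hne : μ₁ ≠ μ₂) :
    ∃ ρ₁ ρ₂ : Measure M, ρ₁ ≤ μ₁ ∧ ρ₂ ≤ μ₂ ∧ F.push ρ₁ = ρ₁ ∧ F.push ρ₂ = ρ₂ ∧ ρ₁ ≠ 0 ∧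
      ρ₂ ≠ 0 ∧ ρ₁ ⟂ₘ ρ₂ := by
  set κ := μ₁ ⊓ μ₂
  have k1 : κ ≤ μ₁ := inf_le_left
  have k2 : κ ≤ μ₂ := inf_le_right
  have : IsFiniteMeasure κ := isFiniteMeasure_of_le μ₁ k1
  have hκ := F.inf_push h₁ h₂
  have e1 : μ₁ - κ + κ = μ₁ := Measure.sub_add_cancel_of_le k1
  have e2 : μ₂ - κ + κ = μ₂ := Measure.sub_add_cancel_of_le k2
  refine ⟨μ₁ - κ, μ₂ - κ, Measure.sub_le, Measure.sub_le, F.sub_push k1 h₁ hκ,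
    F.sub_push k2 h₂ hκ, ?_, ?_, ?_⟩
  · intro h0
    rw [h0, zero_add] at e1
    refine hne (Measure.eq_of_le_of_measure_univ_eq ?_ (by simp))
    rw [← e1]; exact k2
  · intro h0
    rw [h0, zero_add] at e2
    refine hne (Measure.eq_of_le_of_measure_univ_eq ?_ (by simp)).symm
    rw [← e2]; exact k1
  · rw [Measure.mutuallySingular_iff_disjoint, disjoint_iff, ← le_bot_iff]
    -- Adding `κ` back gives a common lower bound of `μ₁` and `μ₂`, hence at most their infimum `κ`;
    -- this forces `σ = 0`.
    set σ := (μ₁ - κ) ⊓ (μ₂ - κ)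
    have hσ : σ + κ ≤ κ := by
      refine le_inf ?_ ?_
      · calc σ + κ ≤ μ₁ - κ + κ := by gcongr; exact inf_le_left
          _ = μ₁ := e1
      · calc σ + κ ≤ μ₂ - κ + κ := by gcongr; exact inf_le_right
          _ = μ₂ := e2
    refine Measure.le_iff.2 fun s hs ↦ ?_
    have := hσ s
    rw [Measure.add_apply] at this
    have h3 : σ s + κ s ≤ 0 + κ s := by simpa using this
    exact (ENNReal.add_le_add_iff_right (measure_ne_top κ s)).1 h3

end Stationary

/-! ### Minimal domains and supports -/

section Domains

variable {d n : ℕ} {M : Type*} [TopologicalSpace M] [ChartedSpace (Euc d) M]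
  {F : ParametricNoise d n M}

instance : Inhabited F.T := ⟨⟨F.a, Metric.mem_closedBall_self F.ε_pos.le⟩⟩

lemma isClosed_closed (D : F.SInvariantDomain) : IsClosed D.closed :=
  isClosed_iUnion_of_finite fun _ ↦ isClosed_closure

lemma step_mem_closed (D : F.SInvariantDomain) {x : M} (hx : x ∈ D.closed) (u : F.T) :
    F.f x u ∈ D.closed := by
  obtain ⟨i, hi⟩ := mem_iUnion.1 hx
  refine mem_iUnion.2 ⟨⟨(1 + i) % D.r, Nat.mod_lt _ D.r_pos⟩, ?_⟩
  obtain ⟨φ, hφ⟩ := F.step_homeomorph u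
  rw [← hφ]
  refine map_mem_closure φ.continuous hi fun y hy ↦ ?_
  rw [hφ]
  exact D.invariant i 1 le_rfl ⟨y, hy, fun _ ↦ u, rfl⟩

lemma step_mem_interior {V : Set M} (hV : ∀ x ∈ V, ∀ u : F.T, F.f x u ∈ V) {x : M}
    (hx : x ∈ interior V) (u : F.T) : F.f x u ∈ interior V := by
  obtain ⟨φ, hφ⟩ := F.step_homeomorph u
  rw [← hφ]
  refine mem_interior.2 ⟨φ '' interior V, ?_, φ.isOpenMap _ isOpen_interior, mem_image_of_mem _ hx⟩
  rintro _ ⟨y, hy, rfl⟩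
  rw [hφ]
  exact hV y (interior_subset hy) u

/-- The members of an s-invariant domain are pairwise disjoint. -/
lemma eq_of_mem_of_mem (D : F.SInvariantDomain) {i j : Fin D.r} {x : M} (hi : x ∈ D.U i)
    (hj : x ∈ D.U j) : i = j := by
  by_contra h
  exact disjoint_left.1 (D.separated i j h) (subset_closure hi) (subset_closure hj)

/-- The trace of a forward invariant open set on an s-invariant domain. -/
def traceDomain (D : F.SInvariantDomain) (V : Set M) (hV : IsOpen V)
    (hinv : ∀ x ∈ V, ∀ u : F.T, F.f x u ∈ V) (hne : ∀ i, (V ∩ D.U i).Nonempty) :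
    F.SInvariantDomain where
  r := D.r
  r_pos := D.r_pos
  U i := V ∩ D.U i
  isOpen i := hV.inter (D.isOpen i)
  nonempty := hne
  separated i j h := (D.separated i j h).mono (closure_mono inter_subset_right)
    (closure_mono inter_subset_right)
  invariant i k hk := by
    rintro _ ⟨z, hz, t, rfl⟩
    exact ⟨F.iter_mem_of_forall_step_mem hinv k hz.1 t, D.invariant i k hk ⟨z, hz.2, t, rfl⟩⟩

lemma inter_nonempty_of_inter_nonempty (D : F.SInvariantDomain) {V : Set M}
    (hinv : ∀ x ∈ V, ∀ u : F.T, F.f x u ∈ V) {i : Fin D.r} (hi : (V ∩ D.U i).Nonempty)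
    (j : Fin D.r) : (V ∩ D.U j).Nonempty := by
  obtain ⟨x, hxV, hx⟩ := hi
  -- From `U i`, a chain is in `U j` after `j + (r - i)` steps, a positive number even if `i = j`.
  have hk : 1 ≤ j + (D.r - i) := by have := i.2; omega
  have := D.invariant i (j + (D.r - i)) hk ⟨x, hx, fun _ ↦ default, rfl⟩
  have hj : (⟨(j + (D.r - i) + i) % D.r, Nat.mod_lt _ D.r_pos⟩ : Fin D.r) = j := by
    ext
    have hi := i.2
    have : (j : ℕ) + (D.r - i) + i = j + D.r := by omega
    simp only [this, Nat.add_mod_right, Nat.mod_eq_of_lt j.2]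
  rw [hj] at this
  exact ⟨_, F.iter_mem_of_forall_step_mem hinv _ hxV _, this⟩

/-- A minimal s-invariant domain is contained in every forward invariant open set it meets. -/
lemma subset_of_isMinimal {D : F.SInvariantDomain} (hD : D.IsMinimal) {V : Set M} (hV : IsOpen V)
    (hinv : ∀ x ∈ V, ∀ u : F.T, F.f x u ∈ V) {i : Fin D.r} (hi : (V ∩ D.U i).Nonempty)
    (j : Fin D.r) : D.U j ⊆ V := by
  have hne := inter_nonempty_of_inter_nonempty D hinv hi
  by_contra hj
  set W := traceDomain D V hV hinv hne with hW
  have hsub : ∀ k, W.cyc k ⊆ D.cyc k := fun k ↦ inter_subset_right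
  have hjj : (⟨(j : ℕ) % D.r, Nat.mod_lt _ D.r_pos⟩ : Fin D.r) = j := by
    ext; exact Nat.mod_eq_of_lt j.2
  have hprec : W.Prec D := by
    refine ⟨j, j, hsub _, fun h ↦ hj ?_, fun k _ ↦ hsub _⟩
    have h' : V ∩ D.U ⟨(j : ℕ) % D.r, Nat.mod_lt _ D.r_pos⟩ =
      D.U ⟨(j : ℕ) % D.r, Nat.mod_lt _ D.r_pos⟩ := h
    rw [hjj] at h'
    exact inter_eq_right.1 h'
  obtain ⟨a, b, hab⟩ := hD W (Or.inr hprec)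
  -- A positive shift with `a + k ≡ j` modulo `r`. It identifies `V ∩ U j` with some member of `D`,
  -- which must be `U j` by disjointness.
  set k := j + D.r * (a + 1) - a with hk
  have hle : a + 1 ≤ D.r * (a + 1) := Nat.le_mul_of_pos_left _ D.r_pos
  have hak : a + k = j + D.r * (a + 1) := by omega
  have h1 := hab k (by omega)
  have h2 : (⟨(a + k) % D.r, Nat.mod_lt _ D.r_pos⟩ : Fin D.r) = j := by
    ext; simp [hak, Nat.mod_eq_of_lt j.2]
  have h3 : V ∩ D.U ⟨(a + k) % D.r, Nat.mod_lt _ D.r_pos⟩ =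
    D.U ⟨(b + k) % D.r, Nat.mod_lt _ D.r_pos⟩ := h1
  rw [h2] at h3
  obtain ⟨x, hx⟩ := hne j
  have h4 := eq_of_mem_of_mem D hx.2 (h3 ▸ hx)
  rw [← h4] at h3
  exact hj (inter_eq_right.1 h3)

end Domains

section Support

variable {d n : ℕ} {M : Type*} [MetricSpace M] [CompactSpace M] [ChartedSpace (Euc d) M]
  [MeasurableSpace M] [BorelSpace M] {F : ParametricNoise d n M}

/-- A stationary measure carried by the closure of a minimal s-invariant domain charges every
open set that meets this closure. -/
lemma closed_subset_support {K : ℕ} {ξ₀ : ℝ} (hξ₀ : 0 < ξ₀) (hA : F.ConditionA K ξ₀)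
    {D : F.SInvariantDomain} (hD : D.IsMinimal) {μ : Measure M} [IsFiniteMeasure μ]
    (hμ : F.push μ = μ) (h0 : μ ≠ 0) (hc : μ D.closedᶜ = 0) : D.closed ⊆ μ.support := by
  have hsup : μ.support ⊆ D.closed :=
    Measure.support_subset_of_isClosed (isClosed_closed D) hc
  have hinv : ∀ x ∈ μ.support, ∀ u : F.T, F.f x u ∈ μ.support :=
    fun x hx u ↦ F.step_mem_support hμ hx u
  obtain ⟨x, hx⟩ := Measure.nonempty_support h0
  -- Forward invariance and condition A give the support an interior. That interior is itself
  -- forward invariant, so minimality applies to it.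
  have hball : Metric.ball ((fun y ↦ F.f y F.a)^[K] x) ξ₀ ⊆ μ.support := by
    refine (hA K le_rfl x).trans ?_
    rintro _ ⟨z, rfl, t, rfl⟩
    exact F.iter_mem_of_forall_step_mem hinv K hx t
  have hc : (fun y ↦ F.f y F.a)^[K] x ∈ interior μ.support :=
    mem_interior.2 ⟨_, hball, Metric.isOpen_ball, Metric.mem_ball_self hξ₀⟩
  obtain ⟨i, hi⟩ := mem_iUnion.1 (hsup (interior_subset hc))
  have hne := mem_closure_iff.1 hi _ isOpen_interior hc
  refine iUnion_subset fun j ↦ closure_minimal ?_ Measure.isClosed_support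
  exact (subset_of_isMinimal hD isOpen_interior (fun x hx u ↦ step_mem_interior hinv hx u) hne
    j).trans interior_subset

end Support

/-! ### Transition probabilities and almost surely invariant sets -/

section TransitionDef

variable {d n : ℕ} {M : Type*} [TopologicalSpace M] [ChartedSpace (Euc d) M]
  (F : ParametricNoise d n M)

/-- The probability of the transition `x → s` in `k` steps. -/
def trans (k : ℕ) (s : Set M) (x : M) : ℝ≥0∞ := F.νInf {t | F.iter k x t ∈ s}

lemma trans_zero (s : Set M) (x : M) : F.trans 0 s x = s.indicator 1 x := by
  by_cases hx : x ∈ s <;> simp [trans, iter, hx]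

/-- The set of the starting points of chains that almost surely never leave `G`. -/
def core (G : Set M) : Set M := {x | ∀ k, F.trans k Gᶜ x = 0}

lemma core_subset (G : Set M) : F.core G ⊆ G := by
  intro x hx
  by_contra h
  simpa [F.trans_zero, h] using hx 0

end TransitionDef

section Transition

variable {d n : ℕ} {M : Type*} [MetricSpace M] [ChartedSpace (Euc d) M]
  [MeasurableSpace M] [BorelSpace M] (F : ParametricNoise d n M)

lemma measurable_trans (k : ℕ) {s : Set M} (hs : MeasurableSet s) : Measurable (F.trans k s) :=
  measurable_measure_prodMk_left (F.measurable_iter k hs)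

lemma measurable_iter_right (k : ℕ) (x : M) : Measurable (F.iter k x) :=
  (F.measurable_iter k).comp measurable_prodMk_left

lemma measurable_step_right (x : M) : Measurable fun u : F.T ↦ F.f x u :=
  F.measurable_step.comp measurable_prodMk_left

lemma trans_succ (k : ℕ) {s : Set M} (hs : MeasurableSet s) (x : M) :
    F.trans (k + 1) s x = ∫⁻ u, F.trans k s (F.f x u) ∂F.ν := by
  have hm : MeasurableSet {t | F.iter (k + 1) x t ∈ s} := F.measurable_iter_right (k + 1) x hs
  rw [trans, ← lintegral_indicator_one hm, F.lintegral_νInf (measurable_one.indicator hm)]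
  refine lintegral_congr fun u ↦ ?_
  have hm' : MeasurableSet {t | F.iter k (F.f x u) t ∈ s} := F.measurable_iter_right k _ hs
  rw [trans, ← lintegral_indicator_one hm']
  refine lintegral_congr fun t ↦ ?_
  have h := F.iter_succ_cons k x u t
  by_cases hs' : F.iter k (F.f x u) t ∈ s
  · simp [indicator, h, hs']
  · simp [indicator, h, hs']

lemma lintegral_trans {μ : Measure M} [SFinite μ] (hμ : F.push μ = μ) (k : ℕ) {s : Set M}
    (hs : MeasurableSet s) : ∫⁻ x, F.trans k s x ∂μ = μ s := by
  induction k with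
  | zero => simp only [F.trans_zero, lintegral_indicator_one hs]
  | succ k ih =>
    simp only [F.trans_succ k hs]
    rw [← F.lintegral_push μ (F.measurable_trans k hs), hμ, ih]

/-- A stationary measure is the average of the `K`-step laws of its points, all absolutely
continuous by condition B. -/
lemma absolutelyContinuous_of_push_eq {m : Measure M} {K : ℕ} (hB : F.ConditionB m K)
    {μ : Measure M} [SFinite μ] (hμ : F.push μ = μ) : μ ≪ m := by
  refine Measure.AbsolutelyContinuous.mk fun s hs h0 ↦ ?_
  rw [← F.lintegral_trans hμ K hs, lintegral_eq_zero_iff (F.measurable_trans K hs)]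
  refine Eventually.of_forall fun x ↦ ?_
  have := hB K le_rfl x h0
  rwa [Measure.map_apply (F.measurable_iter_right K x) hs] at this

lemma measurableSet_core {G : Set M} (hG : MeasurableSet G) : MeasurableSet (F.core G) := by
  have : F.core G = ⋂ k, {x | F.trans k Gᶜ x = 0} := by ext; simp [core]
  rw [this]
  exact .iInter fun k ↦ F.measurable_trans k hG.compl (measurableSet_singleton 0)

/-- The chance of being outside `G` at time `k + 1` averages the time-`k` chances over the first
step. Invariance holds from every point of the core, with no exceptional set of starting points. -/
lemma ae_step_mem_core {G : Set M} (hG : MeasurableSet G) {x : M} (hx : x ∈ F.core G) :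
    ∀ᵐ u : F.T ∂F.ν, F.f x u ∈ F.core G := by
  refine ae_all_iff.2 fun k ↦ ?_
  have := hx (k + 1)
  rw [F.trans_succ k hG.compl] at this
  exact (lintegral_eq_zero_iff
    ((F.measurable_trans k hG.compl).comp (F.measurable_step_right x))).1 this

lemma measure_compl_core {μ : Measure M} [SFinite μ] (hμ : F.push μ = μ) {G : Set M}
    (hG : MeasurableSet G) (h0 : μ Gᶜ = 0) : μ (F.core G)ᶜ = 0 := by
  have : ∀ᵐ x ∂μ, ∀ k, F.trans k Gᶜ x = 0 := by
    refine ae_all_iff.2 fun k ↦ ?_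
    have := F.lintegral_trans hμ k hG.compl
    rw [h0] at this
    exact (lintegral_eq_zero_iff (F.measurable_trans k hG.compl)).1 this
  exact this

end Transition

end RandomPerturbation.ParametricNoise

namespace RandomPerturbation

/-! ### Density points, local estimates and charts -/

section Density

variable {d : ℕ}

/-- The set `s` has full Lebesgue density at `y`. -/
def HasFullDensityAt (s : Set (Euc d)) (y : Euc d) : Prop :=
  Tendsto (fun r ↦ volume (sᶜ ∩ Metric.closedBall y r) / volume (Metric.closedBall y r))
    (𝓝[>] 0) (𝓝 0)

lemma ae_hasFullDensityAt_iff {s : Set (Euc d)} (hs : MeasurableSet s) :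
    ∀ᵐ y, HasFullDensityAt s y ↔ y ∈ s := by
  filter_upwards [Besicovitch.ae_tendsto_measure_inter_div_of_measurableSet volume hs.compl]
    with y hy
  constructor
  · intro h
    by_contra hys
    have := tendsto_nhds_unique hy h
    simp [hys] at this
  · intro hys
    simpa [HasFullDensityAt, hys] using hy

/-- Rescaling the radius by `k` multiplies ball volumes by `k ^ d`, so the relative volume of the
complement changes by a bounded factor only. -/
lemma HasFullDensityAt.of_le {s s' : Set (Euc d)} {y y' : Euc d} {k : ℝ} (hk : 0 < k) {c : ℝ≥0}
    (hle : ∀ᶠ r in 𝓝[>] (0 : ℝ), volume (s'ᶜ ∩ Metric.closedBall y' r) ≤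
      c * volume (sᶜ ∩ Metric.closedBall y (k * r)))
    (hs : HasFullDensityAt s y) : HasFullDensityAt s' y' := by
  have hlim : Tendsto (fun r : ℝ ↦ k * r) (𝓝[>] 0) (𝓝[>] 0) := by
    refine tendsto_nhdsWithin_iff.2 ⟨?_, ?_⟩
    · have : Tendsto (fun r : ℝ ↦ k * r) (𝓝 0) (𝓝 (k * 0)) := (continuous_const_mul k).tendsto 0
      rw [mul_zero] at this
      exact this.mono_left nhdsWithin_le_nhds
    · filter_upwards [self_mem_nhdsWithin] with r hr using mul_pos hk hr
  set q : ℝ≥0∞ := ENNReal.ofReal (k ^ d) with hq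
  have h1 : Tendsto (fun r ↦ (c * q) * (volume (sᶜ ∩ Metric.closedBall y (k * r)) /
      volume (Metric.closedBall y (k * r)))) (𝓝[>] 0) (𝓝 0) := by
    have := ENNReal.Tendsto.const_mul (a := c * q) (hs.comp hlim)
      (Or.inr (ENNReal.mul_ne_top ENNReal.coe_ne_top ENNReal.ofReal_ne_top))
    simpa using this
  refine tendsto_of_tendsto_of_tendsto_of_le_of_le' tendsto_const_nhds h1
    (Eventually.of_forall fun _ ↦ zero_le) ?_
  filter_upwards [hle, self_mem_nhdsWithin] with r hr hr0
  have hr0 : 0 < r := hr0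
  have hvol : volume (Metric.closedBall y (k * r)) = q * volume (Metric.closedBall y' r) := by
    rw [Measure.addHaar_closedBall _ _ hr0.le, Measure.addHaar_closedBall _ _ (mul_pos hk hr0).le,
      mul_pow, ENNReal.ofReal_mul (by positivity), finrank_euclideanSpace_fin, mul_assoc]
  have hq0 : q ≠ 0 := by simp only [hq, ne_eq, ENNReal.ofReal_eq_zero, not_le]; positivity
  have hqt : q ≠ ⊤ := ENNReal.ofReal_ne_top
  calc volume (s'ᶜ ∩ Metric.closedBall y' r) / volume (Metric.closedBall y' r)
      ≤ c * volume (sᶜ ∩ Metric.closedBall y (k * r)) / volume (Metric.closedBall y' r) := by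
        gcongr
    _ = _ := by
        rw [hvol, mul_assoc (c : ℝ≥0∞), ← mul_div_assoc, ENNReal.mul_div_mul_left _ _ hq0 hqt,
          mul_div_assoc]

end Density

section LocalEstimates

variable {E P : Type*} [NormedAddCommGroup E] [NormedSpace ℝ E] [FiniteDimensional ℝ E]
  [MeasurableSpace E] [BorelSpace E] (μ : Measure E) [μ.IsAddHaarMeasure]
  [NormedAddCommGroup P] [NormedSpace ℝ P]

/-- A `C¹` family of maps between spaces of the same dimension, submersive at a point, is uniformly
open and uniformly expands volumes by a bounded factor near this point. -/
lemma _root_.HasStrictFDerivAt.exists_uniform_bounds {G : E × P → E} {G' : E × P →L[ℝ] E}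
    {x₀ : E} {t₀ : P} (hG : HasStrictFDerivAt G G' (x₀, t₀))
    (hsurj : Function.Surjective (G'.comp (ContinuousLinearMap.inl ℝ E P))) :
    ∃ r > 0, ∃ c > 0, ∃ b : ℝ≥0, ∀ᶠ t in 𝓝 t₀,
      (∀ ρ ∈ Icc 0 r, Metric.closedBall (G (x₀, t)) (c * ρ) ⊆
        (fun x ↦ G (x, t)) '' Metric.closedBall x₀ ρ) ∧
      ∀ s ⊆ Metric.closedBall x₀ r, μ ((fun x ↦ G (x, t)) '' s) ≤ b * μ s := by
  set A := G'.comp (ContinuousLinearMap.inl ℝ E P) with hA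
  have hrange : A.range = ⊤ := LinearMap.range_eq_top.2 hsurj
  set B := A.nonlinearRightInverseOfSurjective hrange
  have hB : 0 < B.nnnorm := A.nonlinearRightInverseOfSurjective_nnnorm_pos hrange
  set b : ℝ≥0 := (|A.det|).toNNReal + 1
  have hb : ENNReal.ofReal |A.det| < b := by
    rw [ENNReal.ofReal, ENNReal.coe_lt_coe]
    exact lt_add_one _
  -- This bound keeps the openness constant `‖B‖⁻¹ - δ` positive.
  have hev : ∀ᶠ δ : ℝ≥0 in 𝓝[>] 0, δ < B.nnnorm⁻¹ / 2 :=
    nhdsWithin_le_nhds (Iio_mem_nhds (by positivity))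
  obtain ⟨δ, ⟨hδ, hδB⟩, hδ0⟩ := (((addHaar_image_le_mul_of_det_lt μ A hb).and hev).and
    self_mem_nhdsWithin).exists
  have hδ0 : 0 < δ := hδ0
  obtain ⟨s, hs, hGs⟩ := hG.approximates_deriv_on_nhds (Or.inr hδ0)
  obtain ⟨U, hU, N, hN, hUN⟩ := mem_nhds_prod_iff.1 hs
  obtain ⟨r, hr, hrU⟩ := Metric.nhds_basis_closedBall.mem_iff.1 hU
  refine ⟨r, hr, (B.nnnorm : ℝ)⁻¹ - δ, ?_, b, ?_⟩
  · have : (δ : ℝ) < (B.nnnorm : ℝ)⁻¹ / 2 := by exact_mod_cast hδB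
    have : 0 < (B.nnnorm : ℝ)⁻¹ := by positivity
    linarith
  filter_upwards [hN] with t ht
  -- Strict differentiability compares pairs of points near `(x₀, t₀)`. Pairs sharing the same `t`
  -- see only the partial derivative `A`, hence uniformity in `t`.
  have happ : ApproximatesLinearOn (fun x ↦ G (x, t)) A (Metric.closedBall x₀ r) δ := by
    intro x hx y hy
    have := hGs (x, t) (hUN ⟨hrU hx, ht⟩) (y, t) (hUN ⟨hrU hy, ht⟩)
    have h1 : ((x, t) : E × P) - (y, t) = (x - y, 0) := by simp
    rw [h1, Prod.norm_mk, norm_zero, max_eq_left (norm_nonneg _)] at this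
    simpa [hA] using this
  refine ⟨fun ρ hρ ↦ ?_, fun s hs ↦ hδ _ _ (happ.mono_set hs)⟩
  exact happ.surjOn_closedBall_of_nonlinearRightInverse B hρ.1
    (Metric.closedBall_subset_closedBall hρ.2)

end LocalEstimates

section Charts

variable {d : ℕ} {M : Type*} [TopologicalSpace M] [MeasurableSpace M] [BorelSpace M]

/-- The Lebesgue measure of the chart `e`, transported to `M`. -/
def chartVolume (e : OpenPartialHomeomorph M (Euc d)) : Measure M :=
  (volume.restrict e.target).map e.symm

instance (e : OpenPartialHomeomorph M (Euc d)) : SFinite (chartVolume e) := by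
  unfold chartVolume; infer_instance

lemma aemeasurable_chart_symm (e : OpenPartialHomeomorph M (Euc d)) :
    AEMeasurable e.symm (volume.restrict e.target) :=
  e.continuousOn_symm.aemeasurable e.open_target.measurableSet

lemma chartVolume_apply (e : OpenPartialHomeomorph M (Euc d)) {s : Set M} (hs : MeasurableSet s) :
    chartVolume e s = volume (e.target ∩ e.symm ⁻¹' s) := by
  rw [chartVolume, Measure.map_apply_of_aemeasurable (aemeasurable_chart_symm e) hs,
    Measure.restrict_apply' e.open_target.measurableSet, inter_comm]

lemma measurableSet_target_inter_preimage (e : OpenPartialHomeomorph M (Euc d)) {s : Set M}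
    (hs : MeasurableSet s) : MeasurableSet (e.target ∩ e.symm ⁻¹' s) := by
  have h : Measurable fun y : e.target ↦ e.symm y :=
    (continuousOn_iff_continuous_domRestrict.1 e.continuousOn_symm).measurable
  rw [← Subtype.image_preimage_coe]
  exact e.open_target.measurableSet.subtype_image (h hs)

/-- Finitely many chart domains cover `M`, and in each one `m` has a density with respect to
Lebesgue measure. -/
lemma measure_eq_zero_of_chartVolume [ChartedSpace (Euc d) M] [IsManifold 𝓘(ℝ, Euc d) ∞ M]
    [CompactSpace M] {g : RiemMetric d M} {m : Measure M} (hm : IsNormalizedRiemannianVolume g m) {s : Set M}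
    (hs : MeasurableSet s) (h : ∀ e ∈ atlas (Euc d) M, chartVolume e s = 0) : m s = 0 := by
  obtain ⟨c, hc⟩ := hm.exists_const
  obtain ⟨I, hI⟩ := isCompact_univ.elim_finite_subcover (fun x : M ↦ (chartAt (Euc d) x).source)
    (fun x ↦ (chartAt (Euc d) x).open_source)
    (fun x _ ↦ mem_iUnion.2 ⟨x, mem_chart_source _ x⟩)
  have hsub : s ⊆ ⋃ x ∈ I, s ∩ (chartAt (Euc d) x).source := by
    intro y hy
    obtain ⟨x, hx, hxy⟩ := mem_iUnion₂.1 (hI (mem_univ y))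
    exact mem_iUnion₂.2 ⟨x, hx, hy, hxy⟩
  refine measure_mono_null hsub ((measure_biUnion_null_iff I.countable_toSet).2 fun x _ ↦ ?_)
  set e := chartAt (Euc d) x
  rw [hc e (chart_mem_atlas _ x) _ (hs.inter e.open_source.measurableSet) inter_subset_right]
  have h0 := h e (chart_mem_atlas _ x)
  rw [chartVolume_apply e hs] at h0
  rw [setLIntegral_measure_zero, mul_zero]
  refine measure_mono_null ?_ h0
  rintro _ ⟨y, ⟨hy, hye⟩, rfl⟩
  exact ⟨e.map_source hye, by rwa [mem_preimage, e.left_inv hye]⟩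

end Charts

end RandomPerturbation

namespace RandomPerturbation.ParametricNoise

/-! ### Propagation of density points and uniqueness -/

section LocalCoordinates

variable {d n : ℕ} {M : Type*} [TopologicalSpace M] [ChartedSpace (Euc d) M]
  (F : ParametricNoise d n M)

/-- The family `f` read in the charts `e` (at the source) and `e'` (at the target). -/
def coordMap (e e' : OpenPartialHomeomorph M (Euc d)) (p : Euc d × Euc n) : Euc d :=
  e' (F.f (e.symm p.1) p.2)

variable [IsManifold 𝓘(ℝ, Euc d) ∞ M]

lemma contMDiffOn_atlas {e : OpenPartialHomeomorph M (Euc d)} (he : e ∈ atlas (Euc d) M) :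
    ContMDiffOn 𝓘(ℝ, Euc d) 𝓘(ℝ, Euc d) 1 e e.source :=
  (contMDiffOn_of_mem_maximalAtlas
    (IsManifold.subset_maximalAtlas (I := 𝓘(ℝ, Euc d)) (n := ∞) he)).of_le (by simp)

lemma contMDiffOn_atlas_symm {e : OpenPartialHomeomorph M (Euc d)} (he : e ∈ atlas (Euc d) M) :
    ContMDiffOn 𝓘(ℝ, Euc d) 𝓘(ℝ, Euc d) 1 e.symm e.target :=
  (contMDiffOn_symm_of_mem_maximalAtlas
    (IsManifold.subset_maximalAtlas (I := 𝓘(ℝ, Euc d)) (n := ∞) he)).of_le (by simp)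

lemma contDiffAt_coordMap {e e' : OpenPartialHomeomorph M (Euc d)} (he : e ∈ atlas (Euc d) M)
    (he' : e' ∈ atlas (Euc d) M) {x : M} {t : Euc n} (ht : t ∈ Metric.ball (0 : Euc n) 1)
    (hx : x ∈ e.source) (hy : F.f x t ∈ e'.source) :
    ContDiffAt ℝ 1 (F.coordMap e e') (e x, t) := by
  rw [← contMDiffAt_iff_contDiffAt]
  have hex : e.symm (e x) = x := e.left_inv hx
  have h1 : ContMDiffAt 𝓘(ℝ, Euc d × Euc n) (𝓘(ℝ, Euc d).prod 𝓘(ℝ, Euc n)) 1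
      (fun p : Euc d × Euc n ↦ (e.symm p.1, p.2)) (e x, t) := by
    have hs : ContMDiffAt 𝓘(ℝ, Euc d) 𝓘(ℝ, Euc d) 1 e.symm ((e x, t) : Euc d × Euc n).1 :=
      (contMDiffOn_atlas_symm he).contMDiffAt (e.open_target.mem_nhds (e.map_source hx))
    exact (hs.comp (e x, t) contDiff_fst.contMDiff.contMDiffAt).prodMk
      contDiff_snd.contMDiff.contMDiffAt
  have h2 : ContMDiffAt (𝓘(ℝ, Euc d).prod 𝓘(ℝ, Euc n)) 𝓘(ℝ, Euc d) 1
      (fun p : M × Euc n ↦ F.f p.1 p.2) (e.symm (e x), t) := by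
    rw [hex]
    exact F.contMDiffOn.contMDiffAt (prod_mem_nhds univ_mem (Metric.isOpen_ball.mem_nhds ht))
  have h3 : ContMDiffAt 𝓘(ℝ, Euc d) 𝓘(ℝ, Euc d) 1 e' (F.f (e.symm (e x)) t) := by
    rw [hex]
    exact (contMDiffOn_atlas he').contMDiffAt (e'.open_source.mem_nhds hy)
  exact h3.comp (e x, t) (h2.comp (e x, t) h1)

/-- The inverse diffeomorphism read in the charts is a local `C¹` right inverse; by the chain rule
its derivative is a right inverse of the derivative. -/
lemma surjective_fderiv_coordMap {e e' : OpenPartialHomeomorph M (Euc d)}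
    (he : e ∈ atlas (Euc d) M) (he' : e' ∈ atlas (Euc d) M) {x : M} {t : Euc n}
    (ht : t ∈ Metric.ball (0 : Euc n) 1) (hx : x ∈ e.source) (hy : F.f x t ∈ e'.source) :
    Function.Surjective ((fderiv ℝ (F.coordMap e e') (e x, t)).comp
      (ContinuousLinearMap.inl ℝ (Euc d) (Euc n))) := by
  obtain ⟨φ, hφ⟩ := F.diffeo t ht
  have hG : HasFDerivAt (F.coordMap e e') (fderiv ℝ (F.coordMap e e') (e x, t)) (e x, t) :=
    ((F.contDiffAt_coordMap he he' ht hx hy).differentiableAt one_ne_zero).hasFDerivAt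
  set z := e' (F.f x t)
  have hez : e'.symm z = F.f x t := e'.left_inv hy
  have hxφ : φ.symm (F.f x t) = x := by rw [← hφ]; exact φ.symm_apply_apply x
  set H : Euc d → Euc d := fun w ↦ e (φ.symm (e'.symm w)) with hH
  have hHz : H z = e x := by simp only [hH, hez, hxφ]
  have hHd : ContDiffAt ℝ 1 H z := by
    rw [← contMDiffAt_iff_contDiffAt]
    have h1 : ContMDiffAt 𝓘(ℝ, Euc d) 𝓘(ℝ, Euc d) 1 e'.symm z :=
      (contMDiffOn_atlas_symm he').contMDiffAt (e'.open_target.mem_nhds (e'.map_source hy))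
    have h2 : ContMDiffAt 𝓘(ℝ, Euc d) 𝓘(ℝ, Euc d) 1 φ.symm (e'.symm z) :=
      φ.symm.contMDiff.contMDiffAt
    have h3 : ContMDiffAt 𝓘(ℝ, Euc d) 𝓘(ℝ, Euc d) 1 e (φ.symm (e'.symm z)) := by
      rw [hez, hxφ]
      exact (contMDiffOn_atlas he).contMDiffAt (e.open_source.mem_nhds hx)
    exact h3.comp z (h2.comp z h1)
  have hH' := (hHd.differentiableAt one_ne_zero).hasFDerivAt
  have hpair : HasFDerivAt (fun w ↦ (H w, t)) ((ContinuousLinearMap.inl ℝ (Euc d) (Euc n)).comp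
      (fderiv ℝ H z)) z := by
    convert! hH'.prodMk (hasFDerivAt_const (𝕜 := ℝ) t z) using 1
  have hcomp : HasFDerivAt (fun w ↦ F.coordMap e e' (H w, t))
      ((fderiv ℝ (F.coordMap e e') (e x, t)).comp
        ((ContinuousLinearMap.inl ℝ (Euc d) (Euc n)).comp (fderiv ℝ H z))) z := by
    have hG' : HasFDerivAt (F.coordMap e e') (fderiv ℝ (F.coordMap e e') (e x, t)) (H z, t) := by
      rw [hHz]; exact hG
    exact hG'.comp z hpair
  have hid : (fun w ↦ F.coordMap e e' (H w, t)) =ᶠ[𝓝 z] id := by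
    have hc : ContinuousAt (fun w ↦ φ.symm (e'.symm w)) z :=
      φ.symm.continuous.continuousAt.comp (e'.symm.continuousAt (e'.map_source hy))
    have hmem : ∀ᶠ w in 𝓝 z, φ.symm (e'.symm w) ∈ e.source := by
      refine hc.eventually_mem (e.open_source.mem_nhds ?_)
      rwa [hez, hxφ]
    filter_upwards [hmem, e'.open_target.mem_nhds (e'.map_source hy)] with w hw hw'
    simp only [coordMap, hH, id]
    rw [e.left_inv hw, ← hφ]
    erw [φ.apply_symm_apply]
    exact e'.right_inv hw'
  have huniq := hcomp.unique ((hasFDerivAt_id z).congr_of_eventuallyEq hid)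
  intro v
  exact ⟨fderiv ℝ H z v, by simpa using congrArg (fun L ↦ L v) huniq⟩

end LocalCoordinates

section DensityTransport

variable {d n : ℕ} {M : Type*} [MetricSpace M] [ChartedSpace (Euc d) M]
  [MeasurableSpace M] [BorelSpace M] (F : ParametricNoise d n M)

lemma ae_chartVolume_leave_eq_zero (e : OpenPartialHomeomorph M (Euc d)) {E : Set M}
    (hE : MeasurableSet E) (hinv : ∀ x ∈ E, ∀ᵐ u : F.T ∂F.ν, F.f x u ∈ E) :
    ∀ᵐ u : F.T ∂F.ν, chartVolume e {x | x ∈ E ∧ F.f x u ∉ E} = 0 := by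
  have hm : MeasurableSet {p : M × F.T | ¬ (p.1 ∈ E ∧ F.f p.1 p.2 ∉ E)} :=
    ((measurable_fst hE).inter (F.measurable_step hE.compl)).compl
  have h : ∀ᵐ x ∂chartVolume e, ∀ᵐ u : F.T ∂F.ν, ¬ (x ∈ E ∧ F.f x u ∉ E) := by
    refine Eventually.of_forall fun x ↦ ?_
    by_cases hx : x ∈ E
    · filter_upwards [hinv x hx] with u hu h using h.2 hu
    · exact Eventually.of_forall fun u h ↦ hx h.1
  filter_upwards [(Measure.ae_ae_comm hm).1 h] with u hu
  simpa [ae_iff] using hu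

variable [IsManifold 𝓘(ℝ, Euc d) ∞ M]

/-- Density points of an almost surely forward invariant set are mapped to density points by all
the maps of the family. -/
lemma hasFullDensityAt_step {E : Set M} (hE : MeasurableSet E)
    (hinv : ∀ x ∈ E, ∀ᵐ u : F.T ∂F.ν, F.f x u ∈ E) {e e' : OpenPartialHomeomorph M (Euc d)}
    (he : e ∈ atlas (Euc d) M) (he' : e' ∈ atlas (Euc d) M) {x : M} (u₀ : F.T)
    (hx : x ∈ e.source) (hy : F.f x u₀ ∈ e'.source)
    (h : HasFullDensityAt (e.target ∩ e.symm ⁻¹' E) (e x)) :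
    HasFullDensityAt (e'.target ∩ e'.symm ⁻¹' E) (e' (F.f x u₀)) := by
  have ht : (u₀ : Euc n) ∈ Metric.ball (0 : Euc n) 1 := F.closedBall_subset u₀.2
  have hex : e.symm (e x) = x := e.left_inv hx
  set G := F.coordMap e e'
  have hGd := F.contDiffAt_coordMap he he' ht hx hy
  obtain ⟨r₁, hr₁, c, hc, b, hev⟩ := (hGd.hasStrictFDerivAt one_ne_zero).exists_uniform_bounds
    volume (F.surjective_fderiv_coordMap he he' ht hx hy)
  have hdom : ∀ᶠ p : Euc d × Euc n in 𝓝 (e x, (u₀ : Euc n)),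
      p.1 ∈ e.target ∧ F.f (e.symm p.1) p.2 ∈ e'.source := by
    refine (continuousAt_fst.eventually_mem (e.open_target.mem_nhds (e.map_source hx))).and ?_
    have h1 : ContinuousAt (fun p : M × Euc n ↦ F.f p.1 p.2) (e.symm (e x), (u₀ : Euc n)) := by
      rw [hex]
      exact F.contMDiffOn.continuousOn.continuousAt
        (prod_mem_nhds univ_mem (Metric.isOpen_ball.mem_nhds ht))
    have h2 : ContinuousAt (fun p : Euc d × Euc n ↦ (e.symm p.1, p.2)) (e x, (u₀ : Euc n)) :=
      (ContinuousAt.comp (x := (e x, (u₀ : Euc n))) (g := e.symm) (f := Prod.fst)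
        (e.symm.continuousAt (e.map_source hx)) continuousAt_fst).prodMk continuousAt_snd
    refine (h1.comp (f := fun p : Euc d × Euc n ↦ (e.symm p.1, p.2)) h2).eventually_mem
      (e'.open_source.mem_nhds ?_)
    simpa [hex] using hy
  obtain ⟨U, hU, N, hN, hUN⟩ := mem_nhds_prod_iff.1 hdom
  obtain ⟨r₂, hr₂, hrU⟩ := Metric.nhds_basis_closedBall.mem_iff.1 hU
  -- Radius `r` around the `u₀`-image lies in radius `2 * r` around the image under a nearby `u`,
  -- which is covered by the image of the ball of radius `2 * r / c`.
  have hk : 0 < 2 / c := by positivity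
  have hG0 : G (e x, (u₀ : Euc n)) = e' (F.f x u₀) := by
    simp only [G, coordMap, hex]
  refine h.of_le hk (c := b) ?_
  have hr0 : 0 < min r₁ r₂ / (2 / c) := by positivity
  filter_upwards [Ioc_mem_nhdsGT hr0] with r hr
  have hr' : 2 / c * r ≤ min r₁ r₂ := by
    rw [mul_comm]; exact (le_div_iff₀ hk).1 hr.2
  have hGc : ContinuousAt (fun t : Euc n ↦ G (e x, t)) u₀ :=
    hGd.continuousAt.comp (f := fun t : Euc n ↦ (e x, t)) (by fun_prop)
  have hclose : ∀ᶠ t in 𝓝 (u₀ : Euc n), dist (G (e x, t)) (G (e x, u₀)) < r :=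
    hGc.eventually_mem (Metric.ball_mem_nhds _ hr.1)
  have hall := continuousAt_subtype_val.eventually ((hev.and hN).and hclose)
  -- The parameter `u₀` itself may be exceptional. Parameters for which almost no point of `E`
  -- leaves `E` are dense, so at each scale `r` a nearby one replaces `u₀`.
  obtain ⟨u, hu0, hu⟩ :=
    (Measure.dense_of_ae (F.ae_chartVolume_leave_eq_zero e hE hinv)).exists_mem_open
      isOpen_interior ⟨u₀, mem_interior_iff_mem_nhds.2 hall⟩
  obtain ⟨⟨⟨hu1, hu2⟩, huN⟩, hu3⟩ := interior_subset hu
  have huN : (u : Euc n) ∈ N := huN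
  set B := Metric.closedBall (e x) (2 / c * r)
  have hm : MeasurableSet {z | z ∈ E ∧ F.f z u ∉ E} :=
    hE.inter ((F.measurable_step.comp measurable_prodMk_right) hE.compl)
  rw [mem_ofPred_eq, chartVolume_apply e hm] at hu0
  -- A point missing `E` comes either from a point missing `E` or from one leaving `E` under `u`;
  -- the latter form a null set.
  have hsub : (e'.target ∩ e'.symm ⁻¹' E)ᶜ ∩ Metric.closedBall (e' (F.f x u₀)) r ⊆
      (fun y ↦ G (y, u)) '' ((e.target ∩ e.symm ⁻¹' E)ᶜ ∩ B ∪
        (e.target ∩ e.symm ⁻¹' {z | z ∈ E ∧ F.f z u ∉ E}) ∩ B) := by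
    rintro w ⟨hw, hwr⟩
    have hwB : w ∈ Metric.closedBall (G (e x, u)) (c * (2 / c * r)) := by
      have h1 : c * (2 / c * r) = r + r := by field_simp; ring
      rw [h1, Metric.mem_closedBall]
      rw [← hG0] at hwr
      refine (dist_triangle _ (G (e x, u₀)) _).trans (add_le_add hwr ?_)
      rw [dist_comm]; exact hu3.le
    obtain ⟨y, hyB, rfl⟩ := hu1 _ ⟨by have := hr.1; positivity, hr'.trans (min_le_left _ _)⟩ hwB
    refine ⟨y, ?_, rfl⟩
    have hyU : y ∈ U := hrU (Metric.closedBall_subset_closedBall (hr'.trans (min_le_right _ _)) hyB)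
    obtain ⟨hy1, hy2⟩ : y ∈ e.target ∧ F.f (e.symm y) u ∈ e'.source :=
      hUN (⟨hyU, huN⟩ : (y, (u : Euc n)) ∈ U ×ˢ N)
    by_cases hyE : e.symm y ∈ E
    · refine Or.inr ⟨⟨hy1, hyE, fun h ↦ hw ⟨e'.map_source hy2, ?_⟩⟩, hyB⟩
      change e'.symm (e' (F.f (e.symm y) u)) ∈ E
      rwa [e'.left_inv hy2]
    · exact Or.inl ⟨fun h ↦ hyE h.2, hyB⟩
  have hBr : B ⊆ Metric.closedBall (e x) r₁ :=
    Metric.closedBall_subset_closedBall (hr'.trans (min_le_left _ _))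
  calc volume ((e'.target ∩ e'.symm ⁻¹' E)ᶜ ∩ Metric.closedBall (e' (F.f x u₀)) r)
      ≤ b * volume ((e.target ∩ e.symm ⁻¹' E)ᶜ ∩ B ∪
        (e.target ∩ e.symm ⁻¹' {z | z ∈ E ∧ F.f z u ∉ E}) ∩ B) :=
        (measure_mono hsub).trans (hu2 _ (union_subset (inter_subset_right.trans hBr)
          (inter_subset_right.trans hBr)))
    _ ≤ b * (volume ((e.target ∩ e.symm ⁻¹' E)ᶜ ∩ B) + 0) := by
        gcongr
        refine (measure_union_le _ _).trans ?_
        gcongr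
        exact (measure_mono_null inter_subset_left hu0).le
    _ = b * volume ((e.target ∩ e.symm ⁻¹' E)ᶜ ∩ B) := by rw [add_zero]

/-- With at least one step taken, the step lemma also handles the passage from `e` to an arbitrary
chart `e'`. -/
lemma hasFullDensityAt_iter {E : Set M} (hE : MeasurableSet E)
    (hinv : ∀ x ∈ E, ∀ᵐ u : F.T ∂F.ν, F.f x u ∈ E) {e : OpenPartialHomeomorph M (Euc d)}
    (he : e ∈ atlas (Euc d) M) {x : M} (hx : x ∈ e.source)
    (h : HasFullDensityAt (e.target ∩ e.symm ⁻¹' E) (e x)) (t : F.Δ) (k : ℕ) :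
    ∀ e' ∈ atlas (Euc d) M, F.iter (k + 1) x t ∈ e'.source →
      HasFullDensityAt (e'.target ∩ e'.symm ⁻¹' E) (e' (F.iter (k + 1) x t)) := by
  induction k with
  | zero => exact fun e' he' hy ↦ F.hasFullDensityAt_step hE hinv he he' (t 0) hx hy h
  | succ k ih =>
    exact fun e' he' hy ↦ F.hasFullDensityAt_step hE hinv
      (chart_mem_atlas _ (F.iter (k + 1) x t)) he' (t (k + 1)) (mem_chart_source _ _) hy
      (ih _ (chart_mem_atlas _ _) (mem_chart_source _ _))

variable [CompactSpace M]

/-- There is at most one stationary probability measure on the closure of a minimal s-invariant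
domain. -/
lemma eq_of_push_eq {g : RiemMetric d M} {m : Measure M} (hm : IsNormalizedRiemannianVolume g m)
    {K : ℕ} {ξ₀ : ℝ} (hξ₀ : 0 < ξ₀) (hA : F.ConditionA K ξ₀) (hB : F.ConditionB m K)
    {D : F.SInvariantDomain} (hD : D.IsMinimal) {μ₁ μ₂ : Measure M} [IsProbabilityMeasure μ₁]
    [IsProbabilityMeasure μ₂] (h₁ : F.push μ₁ = μ₁) (h₂ : F.push μ₂ = μ₂)
    (hc₁ : μ₁ D.closedᶜ = 0) (hc₂ : μ₂ D.closedᶜ = 0) : μ₁ = μ₂ := by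
  by_contra hne
  obtain ⟨ρ₁, ρ₂, hle₁, hle₂, hρ₁, hρ₂, hz₁, hz₂, hsing⟩ := F.exists_mutuallySingular h₁ h₂ hne
  have : IsFiniteMeasure ρ₁ := isFiniteMeasure_of_le μ₁ hle₁
  have : IsFiniteMeasure ρ₂ := isFiniteMeasure_of_le μ₂ hle₂
  have hcl₁ : ρ₁ D.closedᶜ = 0 := le_antisymm ((hle₁ _).trans hc₁.le) zero_le
  have hcl₂ : ρ₂ D.closedᶜ = 0 := le_antisymm ((hle₂ _).trans hc₂.le) zero_le
  have hac₁ := F.absolutelyContinuous_of_push_eq hB hρ₁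
  have hac₂ := F.absolutelyContinuous_of_push_eq hB hρ₂
  obtain ⟨s, hs, hs₁, hs₂⟩ := hsing
  have hG : MeasurableSet sᶜ := hs.compl
  set E := F.core sᶜ
  have hE : MeasurableSet E := F.measurableSet_core hG
  have hinv : ∀ x ∈ E, ∀ᵐ u : F.T ∂F.ν, F.f x u ∈ E := fun x hx ↦ F.ae_step_mem_core hG hx
  have hE₁ : ρ₁ Eᶜ = 0 := F.measure_compl_core hρ₁ hG (by rwa [compl_compl])
  have hE₂ : ρ₂ E = 0 := measure_mono_null (F.core_subset _) hs₂
  have hclosed : MeasurableSet D.closed := (isClosed_closed D).measurableSet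
  -- a density point of `E` in `D.closed`
  obtain ⟨e, he, y, hy, hyD, hyE⟩ : ∃ e ∈ atlas (Euc d) M, ∃ y ∈ e.target,
      e.symm y ∈ D.closed ∧ HasFullDensityAt (e.target ∩ e.symm ⁻¹' E) y := by
    by_contra! hcon
    have hnull : m (E ∩ D.closed) = 0 := by
      refine measure_eq_zero_of_chartVolume hm (hE.inter hclosed) fun e he ↦ ?_
      rw [chartVolume_apply e (hE.inter hclosed)]
      refine measure_mono_null ?_
        (ae_iff.1 (ae_hasFullDensityAt_iff (measurableSet_target_inter_preimage e hE)))
      rintro y ⟨hy, hyE, hyD⟩ hiff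
      exact hcon e he y hy hyD (hiff.2 ⟨hy, hyE⟩)
    have : ρ₁ univ = 0 := by
      refine measure_mono_null (fun z _ ↦ ?_)
        (measure_union_null (hac₁ hnull) (measure_union_null hE₁ hcl₁))
      by_cases h1 : z ∈ E <;> by_cases h2 : z ∈ D.closed <;> simp [h1, h2]
    exact hz₁ (Measure.measure_univ_eq_zero.1 this)
  set x := e.symm y
  have hx : x ∈ e.source := e.map_target hy
  rw [← e.right_inv hy] at hyE
  set k := max K 1 - 1
  have hk : k + 1 = max K 1 := Nat.sub_add_cancel (le_max_right _ _)
  set z := (fun y ↦ F.f y F.a)^[k + 1] x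
  set V := Metric.ball z ξ₀
  have hV : V ⊆ F.imageΔ (k + 1) {x} := hA (k + 1) (by rw [hk]; exact le_max_left _ _) x
  -- Every point of `V` is reached from `x`, hence is a density point of `E` in any chart; almost
  -- all density points belong to `E`.
  have hVE : m (V ∩ Eᶜ) = 0 := by
    have hmV : MeasurableSet (V ∩ Eᶜ) := Metric.isOpen_ball.measurableSet.inter hE.compl
    refine measure_eq_zero_of_chartVolume hm hmV fun e' he' ↦ ?_
    rw [chartVolume_apply e' hmV]
    refine measure_mono_null ?_
      (ae_iff.1 (ae_hasFullDensityAt_iff (measurableSet_target_inter_preimage e' hE)))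
    rintro w ⟨hw, hwV, hwE⟩ hiff
    obtain ⟨_, rfl, t, ht⟩ := hV hwV
    have := F.hasFullDensityAt_iter hE hinv he hx hyE t k e' he'
      (by rw [ht]; exact e'.map_target hw)
    rw [ht, e'.right_inv hw] at this
    exact hwE (hiff.1 this).2
  have hV0 : ρ₂ V = 0 := by
    refine measure_mono_null (fun w hw ↦ ?_) (measure_union_null (hac₂ hVE) hE₂)
    by_cases hwE : w ∈ E
    · exact Or.inr hwE
    · exact Or.inl ⟨hw, hwE⟩
  have hz : ∀ j, (fun y ↦ F.f y F.a)^[j] x ∈ D.closed := by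
    intro j
    induction j with
    | zero => exact hyD
    | succ j ih =>
      rw [Function.iterate_succ_apply']
      exact step_mem_closed D ih default
  have hsup := closed_subset_support hξ₀ hA hD hρ₂ hz₂ hcl₂ (hz (k + 1))
  exact ((Measure.mem_support_iff_forall _).1 hsup V (Metric.ball_mem_nhds z hξ₀)).ne' hV0

end DensityTransport

/-! ### The strong law by exponential moments -/

section LawOfLargeNumbers

variable {d n : ℕ} {M : Type*} [MetricSpace M] [CompactSpace M] [ChartedSpace (Euc d) M]
  (F : ParametricNoise d n M)

/-- The Markov operator on continuous functions. -/
def markov (φ : C(M, ℝ)) : C(M, ℝ) where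
  toFun x := ∫ u : F.T, φ (F.f x u) ∂F.ν
  continuous_toFun := by
    refine continuous_of_dominated (bound := fun _ ↦ ‖φ‖) (fun x ↦ ?_) (fun x ↦ ?_)
      (integrable_const _) ?_
    · exact (φ.continuous.comp
        (F.continuous_step.comp (Continuous.prodMk_right x))).aestronglyMeasurable
    · exact Eventually.of_forall fun u ↦ φ.norm_coe_le_norm _
    · exact Eventually.of_forall fun u ↦
        φ.continuous.comp (F.continuous_step.comp (Continuous.prodMk_left u))

lemma markov_apply (φ : C(M, ℝ)) (x : M) : F.markov φ x = ∫ u : F.T, φ (F.f x u) ∂F.ν := rfl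

lemma markov_neg (φ : C(M, ℝ)) : F.markov (-φ) = -F.markov φ := by
  ext x; simp [markov_apply, integral_neg]

lemma abs_markov_le (φ : C(M, ℝ)) (x : M) : |F.markov φ x| ≤ ‖φ‖ := by
  have := norm_integral_le_of_norm_le_const (μ := F.ν) (f := fun u : F.T ↦ φ (F.f x u))
    (Eventually.of_forall fun u ↦ φ.norm_coe_le_norm _)
  rw [markov_apply, ← Real.norm_eq_abs]
  simpa using this

/-- The martingale `∑_{j < N} (φ(X_{j+1}) - Pφ(X_j))` along the chain. -/
def mart (φ : C(M, ℝ)) (N : ℕ) (x : M) (t : F.Δ) : ℝ :=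
  ∑ j ∈ Finset.range N, (φ (F.iter (j + 1) x t) - F.markov φ (F.iter j x t))

lemma mart_neg (φ : C(M, ℝ)) (N : ℕ) (x : M) (t : F.Δ) :
    F.mart (-φ) N x t = -F.mart φ N x t := by
  simp only [mart, markov_neg, ContinuousMap.neg_apply, ← Finset.sum_neg_distrib]
  exact Finset.sum_congr rfl fun _ _ ↦ by ring

lemma continuous_mart (φ : C(M, ℝ)) (N : ℕ) (x : M) : Continuous (F.mart φ N x) := by
  have h : ∀ j, Continuous (F.iter j x) := fun j ↦
    (F.continuous_iter j).comp (Continuous.prodMk_right x)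
  exact continuous_finsetSum _ fun j _ ↦
    (φ.continuous.comp (h (j + 1))).sub ((F.markov φ).continuous.comp (h j))

lemma mart_succ_cons (φ : C(M, ℝ)) (N : ℕ) (x : M) (u : F.T) (t : F.Δ) :
    F.mart φ (N + 1) x (F.cons (u, t)) =
      (φ (F.f x u) - F.markov φ x) + F.mart φ N (F.f x u) t := by
  simp only [mart, Finset.sum_range_succ', F.iter_succ_cons]
  rw [add_comm]
  rfl

/-- The increment is centred and bounded by `c`; integrate `exp s ≤ 1 + s + s ^ 2`, valid for `|s| ≤
1`. -/
lemma lintegral_exp_increment_le (φ : C(M, ℝ)) {c l : ℝ} (hc : 2 * ‖φ‖ ≤ c) (hl : 0 ≤ l)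
    (hlc : l * c ≤ 1) (x : M) :
    ∫⁻ u : F.T, ENNReal.ofReal (Real.exp (l * (φ (F.f x u) - F.markov φ x))) ∂F.ν ≤
      ENNReal.ofReal (Real.exp (l ^ 2 * c ^ 2)) := by
  set y : F.T → ℝ := fun u ↦ φ (F.f x u) - F.markov φ x with hy
  have hφc : Continuous fun u : F.T ↦ φ (F.f x u) :=
    φ.continuous.comp (F.continuous_step.comp (Continuous.prodMk_right x))
  have hyc : Continuous y := hφc.sub continuous_const
  have hyb : ∀ u, |y u| ≤ c := fun u ↦ by
    have h1 := φ.norm_coe_le_norm (F.f x u)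
    have h2 := F.abs_markov_le φ x
    rw [Real.norm_eq_abs] at h1
    exact (abs_sub _ _).trans (by linarith)
  have hy0 : ∫ u, y u ∂F.ν = 0 := by
    rw [hy, integral_sub (F.integrable_of_continuous hφc) (integrable_const _), markov_apply]
    simp
  have hexp : Continuous fun u ↦ Real.exp (l * y u) := by fun_prop
  rw [← ofReal_integral_eq_lintegral_ofReal (F.integrable_of_continuous hexp)
    (Eventually.of_forall fun u ↦ (Real.exp_pos _).le)]
  refine ENNReal.ofReal_le_ofReal ?_
  calc ∫ u, Real.exp (l * y u) ∂F.ν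
      ≤ ∫ u, (1 + l ^ 2 * c ^ 2 + l * y u) ∂F.ν := by
        refine integral_mono (F.integrable_of_continuous hexp)
          (F.integrable_of_continuous (by fun_prop)) fun u ↦ ?_
        have h1 : |l * y u| ≤ l * c := by
          rw [abs_mul, abs_of_nonneg hl]
          exact mul_le_mul_of_nonneg_left (hyb u) hl
        have h2 := (abs_le.1 (Real.abs_exp_sub_one_sub_id_le (h1.trans hlc))).2
        have h3 : (l * y u) ^ 2 ≤ (l * c) ^ 2 :=
          sq_le_sq' (by linarith [abs_le.1 h1]) (abs_le.1 h1).2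
        have h4 : (l * c) ^ 2 = l ^ 2 * c ^ 2 := by ring
        simp only
        linarith
    _ = 1 + l ^ 2 * c ^ 2 := by
        rw [integral_add (integrable_const _) ((F.integrable_of_continuous hyc).const_mul l),
          integral_const_mul, hy0]
        simp
    _ ≤ Real.exp (l ^ 2 * c ^ 2) := by linarith [Real.add_one_le_exp (l ^ 2 * c ^ 2)]

lemma lintegral_exp_mart_le (φ : C(M, ℝ)) {c l : ℝ} (hc : 2 * ‖φ‖ ≤ c) (hl : 0 ≤ l)
    (hlc : l * c ≤ 1) (N : ℕ) (x : M) :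
    ∫⁻ t, ENNReal.ofReal (Real.exp (l * F.mart φ N x t)) ∂F.νInf ≤
      ENNReal.ofReal (Real.exp (l ^ 2 * c ^ 2)) ^ N := by
  induction N generalizing x with
  | zero => simp [mart]
  | succ N ih =>
    have hm := F.continuous_mart φ (N + 1) x
    rw [F.lintegral_νInf (by fun_prop)]
    simp only [F.mart_succ_cons, mul_add, Real.exp_add, ENNReal.ofReal_mul (Real.exp_pos _).le]
    calc _ ≤ ∫⁻ u : F.T, ENNReal.ofReal (Real.exp (l * (φ (F.f x u) - F.markov φ x))) *
          ENNReal.ofReal (Real.exp (l ^ 2 * c ^ 2)) ^ N ∂F.ν := by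
          refine lintegral_mono fun u ↦ ?_
          have hm := F.continuous_mart φ N (F.f x u)
          rw [lintegral_const_mul _ (by fun_prop)]
          gcongr
          exact ih _
      _ ≤ _ := by
          rw [lintegral_mul_const' _ _ (ENNReal.pow_ne_top ENNReal.ofReal_ne_top),
            pow_succ' _ N]
          exact mul_le_mul' (F.lintegral_exp_increment_le φ hc hl hlc x) le_rfl

/-- Chernoff's bound makes the probabilities of the bad events decay geometrically; Borel–Cantelli
concludes. -/
lemma ae_eventually_mart_lt (φ : C(M, ℝ)) (x : M) {ε : ℝ} (hε : 0 < ε) (hε1 : ε ≤ 1) :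
    ∀ᵐ t ∂F.νInf, ∀ᶠ N : ℕ in atTop, F.mart φ N x t < ε * N := by
  set c := 2 * ‖φ‖ + 1 with hc
  have hc1 : 1 ≤ c := by linarith [norm_nonneg φ]
  -- The minimizer of `l ^ 2 * c ^ 2 - l * ε`.
  set l := ε / (2 * c ^ 2) with hl
  have hl0 : 0 < l := by positivity
  have hlc : l * c ≤ 1 := by
    rw [hl, div_mul_eq_mul_div, div_le_one (by positivity)]
    nlinarith
  have hexp : l ^ 2 * c ^ 2 - l * ε < 0 := by
    have : l ^ 2 * c ^ 2 = l * ε / 2 := by rw [hl]; field_simp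
    rw [this]
    nlinarith [mul_pos hl0 hε]
  set q : ℝ≥0∞ := ENNReal.ofReal (Real.exp (l ^ 2 * c ^ 2 - l * ε)) with hq
  have hq1 : q < 1 := by
    rw [hq, ENNReal.ofReal_lt_one]
    exact Real.exp_lt_one_iff.2 hexp
  have hbound : ∀ N : ℕ, F.νInf {t | ε * N ≤ F.mart φ N x t} ≤ q ^ N := by
    intro N
    have hm := F.continuous_mart φ N x
    set a : ℝ≥0∞ := ENNReal.ofReal (Real.exp (l * (ε * N))) with ha
    have ha0 : a ≠ 0 := by simp [ha, Real.exp_pos]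
    have h1 := mul_meas_ge_le_lintegral (μ := F.νInf)
      (f := fun t ↦ ENNReal.ofReal (Real.exp (l * F.mart φ N x t))) (by fun_prop) a
    have h2 := h1.trans (F.lintegral_exp_mart_le φ (by linarith) hl0.le hlc N x)
    have h3 : {t | ε * N ≤ F.mart φ N x t} ⊆
        {t | a ≤ ENNReal.ofReal (Real.exp (l * F.mart φ N x t))} := by
      intro t ht
      exact ENNReal.ofReal_le_ofReal (Real.exp_le_exp.2 (mul_le_mul_of_nonneg_left ht hl0.le))
    have h4 : ENNReal.ofReal (Real.exp (l ^ 2 * c ^ 2)) ^ N = a * q ^ N := by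
      rw [ha, hq, ← ENNReal.ofReal_pow (Real.exp_pos _).le, ← ENNReal.ofReal_pow (Real.exp_pos _).le,
        ← ENNReal.ofReal_mul (Real.exp_pos _).le, ← Real.exp_nat_mul, ← Real.exp_nat_mul,
        ← Real.exp_add]
      congr 2; ring
    rw [h4] at h2
    exact (measure_mono h3).trans
      ((ENNReal.mul_le_mul_iff_right ha0 ENNReal.ofReal_ne_top).1 h2)
  have hsum : ∑' N : ℕ, F.νInf {t | ε * N ≤ F.mart φ N x t} ≠ ⊤ := by
    refine ne_top_of_le_ne_top ?_ (ENNReal.tsum_le_tsum hbound)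
    rw [ENNReal.tsum_geometric]
    exact ENNReal.inv_ne_top.2 (tsub_pos_iff_lt.2 hq1).ne'
  filter_upwards [ae_eventually_notMem hsum] with t ht
  filter_upwards [ht] with N hN
  exact not_le.1 hN

/-- The strong law of large numbers for the increments of the chain. -/
lemma ae_tendsto_mart (φ : C(M, ℝ)) (x : M) :
    ∀ᵐ t ∂F.νInf, Tendsto (fun N : ℕ ↦ (N : ℝ)⁻¹ * F.mart φ N x t) atTop (𝓝 0) := by
  have hpos : ∀ k : ℕ, (0 : ℝ) < 1 / (k + 1) := fun k ↦ by positivity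
  have hle : ∀ k : ℕ, (1 : ℝ) / (k + 1) ≤ 1 := fun k ↦ by
    rw [div_le_one (by positivity)]; linarith [(k.cast_nonneg : (0 : ℝ) ≤ k)]
  filter_upwards [ae_all_iff.2 fun k : ℕ ↦ F.ae_eventually_mart_lt φ x (hpos k) (hle k),
    ae_all_iff.2 fun k : ℕ ↦ F.ae_eventually_mart_lt (-φ) x (hpos k) (hle k)] with t h1 h2
  refine Metric.tendsto_nhds.2 fun ε hε ↦ ?_
  obtain ⟨k, hk⟩ := exists_nat_one_div_lt hε
  filter_upwards [h1 k, h2 k, eventually_gt_atTop 0] with N hN1 hN2 hN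
  rw [F.mart_neg] at hN2
  have hN' : (0 : ℝ) < N := by exact_mod_cast hN
  rw [Real.dist_eq, sub_zero, abs_mul, abs_of_pos (inv_pos.2 hN'), inv_mul_lt_iff₀ hN']
  refine abs_lt.2 ⟨?_, ?_⟩ <;> nlinarith

/-- Along almost every trajectory, the law of large numbers holds for a dense set of functions. -/
lemma ae_tendsto_mart_denseSeq (x : M) :
    ∀ᵐ t ∂F.νInf, ∀ i, Tendsto (fun N : ℕ ↦
      (N : ℝ)⁻¹ * F.mart (TopologicalSpace.denseSeq C(M, ℝ) i) N x t) atTop (𝓝 0) :=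
  ae_all_iff.2 fun _ ↦ F.ae_tendsto_mart _ x

end LawOfLargeNumbers

/-! ### Limits of empirical measures: existence and generic points -/

section Empirical

variable {d n : ℕ} {M : Type*} [MetricSpace M] [CompactSpace M] [ChartedSpace (Euc d) M]
  [MeasurableSpace M] [BorelSpace M] (F : ParametricNoise d n M)

/-- The empirical distribution of the first `N + 1` points of a trajectory. -/
def empirical (x : M) (t : F.Δ) (N : ℕ) : ProbabilityMeasure M :=
  ⟨((N + 1 : ℕ) : ℝ≥0∞)⁻¹ • ∑ j ∈ Finset.range (N + 1), Measure.dirac (F.iter j x t), ⟨by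
    rw [Measure.smul_apply, Measure.finsetSum_apply]
    simp only [measure_univ, Finset.sum_const, Finset.card_range, nsmul_eq_mul, mul_one,
      smul_eq_mul]
    exact ENNReal.inv_mul_cancel (by simp) (ENNReal.natCast_ne_top _)⟩⟩

lemma integrable_continuousMap (μ : Measure M) [IsFiniteMeasure μ] (φ : C(M, ℝ)) :
    Integrable φ μ :=
  φ.continuous.integrable_of_hasCompactSupport (HasCompactSupport.of_compactSpace _)

lemma integral_empirical (x : M) (t : F.Δ) (N : ℕ) (φ : C(M, ℝ)) :
    ∫ y, φ y ∂(F.empirical x t N : Measure M) =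
      ((N + 1 : ℕ) : ℝ)⁻¹ * ∑ j ∈ Finset.range (N + 1), φ (F.iter j x t) := by
  change ∫ y, φ y ∂(((N + 1 : ℕ) : ℝ≥0∞)⁻¹ •
    ∑ j ∈ Finset.range (N + 1), Measure.dirac (F.iter j x t)) = _
  rw [integral_smul_measure, integral_finsetSum_measure fun j _ ↦ integrable_continuousMap _ φ,
    ENNReal.toReal_inv, ENNReal.toReal_natCast, smul_eq_mul]
  simp only [integral_dirac]

lemma tendsto_integral_of_tendsto {ι : Type*} {l : Filter ι} {μs : ι → ProbabilityMeasure M}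
    {μ : ProbabilityMeasure M} (h : Tendsto μs l (𝓝 μ)) (φ : C(M, ℝ)) :
    Tendsto (fun i ↦ ∫ y, φ y ∂(μs i : Measure M)) l (𝓝 (∫ y, φ y ∂(μ : Measure M))) :=
  ProbabilityMeasure.tendsto_iff_forall_integral_tendsto.1 h
    (BoundedContinuousFunction.mkOfCompact φ)

lemma integral_push (μ : Measure M) [IsFiniteMeasure μ] (φ : C(M, ℝ)) :
    ∫ y, φ y ∂F.push μ = ∫ y, F.markov φ y ∂μ := by
  have hc : Continuous fun p : M × F.T ↦ φ (F.step p) := φ.continuous.comp F.continuous_step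
  rw [push, integral_map F.measurable_step.aemeasurable φ.continuous.aestronglyMeasurable,
    integral_prod _ (hc.integrable_of_hasCompactSupport (HasCompactSupport.of_compactSpace _))]
  rfl

lemma continuous_integral_continuousMap (μ : Measure M) [IsFiniteMeasure μ] :
    Continuous fun φ : C(M, ℝ) ↦ ∫ y, φ y ∂μ := by
  refine (LipschitzWith.of_dist_le_mul (K := (μ.real univ).toNNReal) fun φ ψ ↦ ?_).continuous
  rw [Real.dist_eq, ← integral_sub (integrable_continuousMap μ φ) (integrable_continuousMap μ ψ),
    Real.coe_toNNReal _ measureReal_nonneg, mul_comm]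
  refine norm_integral_le_of_norm_le_const (μ := μ) (f := fun y ↦ φ y - ψ y)
    (Eventually.of_forall fun y ↦ ?_)
  rw [← dist_eq_norm]
  exact ContinuousMap.dist_apply_le_dist y

lemma ext_of_denseSeq {μ μ' : Measure M} [IsFiniteMeasure μ] [IsFiniteMeasure μ']
    (h : ∀ i, ∫ y, TopologicalSpace.denseSeq C(M, ℝ) i y ∂μ =
      ∫ y, TopologicalSpace.denseSeq C(M, ℝ) i y ∂μ') : μ = μ' := by
  refine ext_of_forall_integral_eq_of_IsFiniteMeasure fun φ ↦ ?_
  exact (TopologicalSpace.denseRange_denseSeq C(M, ℝ)).induction_on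
    (p := fun ψ : C(M, ℝ) ↦ ∫ y, ψ y ∂μ = ∫ y, ψ y ∂μ') φ.toContinuousMap
    (isClosed_eq (continuous_integral_continuousMap μ) (continuous_integral_continuousMap μ')) h

/-- Along a trajectory, the sums of `φ - F.markov φ` differ from the martingale by the bounded
telescoping term `φ x - φ (F.iter (N + 1) x t)`. -/
lemma tendsto_integral_sub_markov {x : M} {t : F.Δ} {φ : C(M, ℝ)}
    (h : Tendsto (fun N : ℕ ↦ (N : ℝ)⁻¹ * F.mart φ N x t) atTop (𝓝 0)) :
    Tendsto (fun N : ℕ ↦ ∫ y, (φ - F.markov φ) y ∂(F.empirical x t N : Measure M)) atTop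
      (𝓝 0) := by
  have h1 := h.comp (tendsto_add_atTop_nat 1)
  have h2 : Tendsto (fun N : ℕ ↦ ((N + 1 : ℕ) : ℝ)⁻¹ * (φ x - φ (F.iter (N + 1) x t))) atTop
      (𝓝 0) := by
    have h3 : Tendsto (fun N : ℕ ↦ ((N + 1 : ℕ) : ℝ)⁻¹) atTop (𝓝 0) :=
      (tendsto_inv_atTop_nhds_zero_nat (𝕜 := ℝ)).comp (tendsto_add_atTop_nat 1)
    refine h3.zero_mul_isBoundedUnder_le ?_
    refine isBoundedUnder_of ⟨2 * ‖φ‖, fun N ↦ ?_⟩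
    have h4 := φ.norm_coe_le_norm x
    have h5 := φ.norm_coe_le_norm (F.iter (N + 1) x t)
    exact (norm_sub_le _ _).trans (by linarith)
  have h6 := h1.add h2
  rw [add_zero] at h6
  refine h6.congr fun N ↦ ?_
  rw [F.integral_empirical]
  simp only [Function.comp_apply, mart]
  rw [← mul_add]
  congr 1
  have h7 := Finset.sum_range_sub (fun j ↦ φ (F.iter j x t)) (N + 1)
  have h8 : F.iter 0 x t = x := rfl
  simp only [Finset.sum_sub_distrib, h8, ContinuousMap.sub_apply] at h7 ⊢
  linarith

lemma push_eq_of_tendsto_empirical {x : M} {t : F.Δ}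
    (h : ∀ i, Tendsto (fun N : ℕ ↦
      (N : ℝ)⁻¹ * F.mart (TopologicalSpace.denseSeq C(M, ℝ) i) N x t) atTop (𝓝 0))
    {l : Filter ℕ} [l.NeBot] (hl : l ≤ atTop) {μ : ProbabilityMeasure M}
    (hμ : Tendsto (F.empirical x t) l (𝓝 μ)) : F.push (μ : Measure M) = μ := by
  refine ext_of_denseSeq fun i ↦ ?_
  set φ := TopologicalSpace.denseSeq C(M, ℝ) i
  have h1 := tendsto_integral_of_tendsto hμ (φ - F.markov φ)
  have h2 := tendsto_nhds_unique h1 ((F.tendsto_integral_sub_markov (h i)).mono_left hl)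
  simp only [ContinuousMap.sub_apply] at h2
  rw [integral_sub (integrable_continuousMap _ φ) (integrable_continuousMap _ _)] at h2
  rw [F.integral_push]
  linarith

lemma measure_compl_eq_zero_of_tendsto_empirical {x : M} {t : F.Δ} {C : Set M} (hC : IsClosed C)
    (hne : C.Nonempty) (h : ∀ j, F.iter j x t ∈ C) {l : Filter ℕ} [l.NeBot]
    {μ : ProbabilityMeasure M} (hμ : Tendsto (F.empirical x t) l (𝓝 μ)) :
    (μ : Measure M) Cᶜ = 0 := by
  set φ : C(M, ℝ) := ⟨fun y ↦ Metric.infDist y C, Metric.continuous_infDist_pt C⟩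
  have h1 := tendsto_integral_of_tendsto hμ φ
  have h2 : ∀ N, ∫ y, φ y ∂(F.empirical x t N : Measure M) = 0 := by
    intro N
    rw [F.integral_empirical, Finset.sum_eq_zero, mul_zero]
    exact fun j _ ↦ Metric.infDist_zero_of_mem (h j)
  simp only [h2] at h1
  have h3 := tendsto_nhds_unique h1 tendsto_const_nhds
  have h4 := (integral_eq_zero_iff_of_nonneg (fun y ↦ Metric.infDist_nonneg)
    (integrable_continuousMap (μ : Measure M) φ)).1 h3
  filter_upwards [h4] with y hy
  exact (hC.mem_iff_infDist_zero hne).2 hy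

/-- A closed forward invariant set carries a stationary probability measure. -/
lemma exists_push_eq {C : Set M} (hC : IsClosed C) (hne : C.Nonempty)
    (hinv : ∀ x ∈ C, ∀ u : F.T, F.f x u ∈ C) :
    ∃ μ : Measure M, IsProbabilityMeasure μ ∧ F.push μ = μ ∧ μ Cᶜ = 0 := by
  obtain ⟨x, hx⟩ := hne
  obtain ⟨t, ht⟩ := (F.ae_tendsto_mart_denseSeq x).exists
  set 𝒰 : Ultrafilter ℕ := Ultrafilter.of atTop
  have hlim : Tendsto (F.empirical x t) 𝒰 (𝓝 (𝒰.map (F.empirical x t)).lim) :=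
    (𝒰.map (F.empirical x t)).le_nhds_lim
  exact ⟨_, inferInstance, F.push_eq_of_tendsto_empirical ht (Ultrafilter.of_le _) hlim,
    F.measure_compl_eq_zero_of_tendsto_empirical hC ⟨x, hx⟩
      (fun j ↦ F.iter_mem_of_forall_step_mem hinv j hx t) hlim⟩

/-- If a closed forward invariant set carries a unique stationary probability measure, then all
its points are generic for this measure. -/
lemma subset_basin_of_unique {C : Set M} (hC : IsClosed C)
    (hinv : ∀ x ∈ C, ∀ u : F.T, F.f x u ∈ C) {μ : Measure M} [IsProbabilityMeasure μ]
    (huniq : ∀ μ' : Measure M, IsProbabilityMeasure μ' → F.push μ' = μ' → μ' Cᶜ = 0 → μ' = μ) :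
    C ⊆ F.basin μ := by
  intro x hx
  filter_upwards [F.ae_tendsto_mart_denseSeq x] with t ht φ
  have hlim : Tendsto (F.empirical x t) atTop (𝓝 ⟨μ, inferInstance⟩) := by
    -- By compactness there is a limit along each ultrafilter; it is stationary and carried by `C`,
    -- hence equal to `μ`.
    refine (tendsto_iff_ultrafilter _ _ _).2 fun 𝒰 h𝒰 ↦ ?_
    have hlim : Tendsto (F.empirical x t) 𝒰 (𝓝 (𝒰.map (F.empirical x t)).lim) :=
      (𝒰.map (F.empirical x t)).le_nhds_lim
    have heq : (⟨μ, inferInstance⟩ : ProbabilityMeasure M) =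
        (𝒰.map (F.empirical x t)).lim := Subtype.ext (huniq _ inferInstance
          (F.push_eq_of_tendsto_empirical ht h𝒰 hlim)
      (F.measure_compl_eq_zero_of_tendsto_empirical hC ⟨x, hx⟩
        (fun j ↦ F.iter_mem_of_forall_step_mem hinv j hx t) hlim)).symm
    rw [heq]
    exact hlim
  refine (tendsto_add_atTop_iff_nat 1).1 ?_
  refine (tendsto_integral_of_tendsto hlim φ).congr fun N ↦ ?_
  rw [F.integral_empirical]

end Empirical

/-! ### Ergodicity from uniqueness -/

section FiberProbability

variable {d n : ℕ} {M : Type*} [TopologicalSpace M] [ChartedSpace (Euc d) M]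
  (F : ParametricNoise d n M)

/-- The conditional probability, given the starting point, of an event on `M × Δ`. -/
def fiberProb (A : Set (M × F.Δ)) (x : M) : ℝ≥0∞ := F.νInf {t | (x, t) ∈ A}

lemma mem_cons_iff {A : Set (M × F.Δ)} (hS : F.S ⁻¹' A = A) (x : M) (u : F.T) (t : F.Δ) :
    (x, F.cons (u, t)) ∈ A ↔ (F.f x u, t) ∈ A := by
  conv_lhs => rw [← hS]
  rfl

lemma measurable_fiberProb [MeasurableSpace M] {A : Set (M × F.Δ)} (hA : MeasurableSet A) :
    Measurable (F.fiberProb A) := measurable_measure_prodMk_left hA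

lemma fiberProb_eq_lintegral [MeasurableSpace M] {A : Set (M × F.Δ)}
    (hA : MeasurableSet A) (hS : F.S ⁻¹' A = A)
    (x : M) : F.fiberProb A x = ∫⁻ u : F.T, F.fiberProb A (F.f x u) ∂F.ν := by
  have hAx : MeasurableSet {t | (x, t) ∈ A} := measurable_prodMk_left hA
  rw [fiberProb, F.νInf_apply hAx]
  simp only [mem_ofPred_eq, F.mem_cons_iff hS, fiberProb]

end FiberProbability

section Ergodicity

variable {d n : ℕ} {M : Type*} [MetricSpace M] [ChartedSpace (Euc d) M]
  [MeasurableSpace M] [BorelSpace M] (F : ParametricNoise d n M)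

/-- The truncation `min h q` of the harmonic `h` is superharmonic, hence harmonic almost everywhere
by stationarity. Where it equals its upper bound `q`, it must equal `q` after almost every step. -/
lemma ae_step_mem_superlevel {μ : Measure M} [IsProbabilityMeasure μ] (hμ : F.push μ = μ)
    {h : M → ℝ≥0∞} (hm : Measurable h) (hP : ∀ x, h x = ∫⁻ u : F.T, h (F.f x u) ∂F.ν)
    {q : ℝ≥0∞} (hq : q ≠ ⊤) : ∀ᵐ x ∂μ, q ≤ h x → ∀ᵐ u : F.T ∂F.ν, q ≤ h (F.f x u) := by
  set k : M → ℝ≥0∞ := fun x ↦ min (h x) q with hk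
  have hkm : Measurable k := hm.min measurable_const
  have hle : ∀ x, ∫⁻ u : F.T, k (F.f x u) ∂F.ν ≤ k x := by
    intro x
    refine le_min ?_ ?_
    · rw [hP x]
      exact lintegral_mono fun u ↦ min_le_left _ _
    · calc ∫⁻ u : F.T, k (F.f x u) ∂F.ν ≤ ∫⁻ _ : F.T, q ∂F.ν :=
          lintegral_mono fun u ↦ min_le_right _ _
        _ = q := by simp
  have hfin : ∫⁻ x, ∫⁻ u : F.T, k (F.f x u) ∂F.ν ∂μ ≠ ⊤ := by
    rw [← F.lintegral_push μ hkm, hμ]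
    refine ne_top_of_le_ne_top hq ?_
    calc ∫⁻ x, k x ∂μ ≤ ∫⁻ _, q ∂μ := lintegral_mono fun x ↦ min_le_right _ _
      _ = q := by simp
  have heq := ae_eq_of_ae_le_of_lintegral_le (Eventually.of_forall hle) hfin hkm.aemeasurable
    (by rw [← F.lintegral_push μ hkm, hμ])
  filter_upwards [heq] with x hx hqx
  have hkx : k x = q := min_eq_right hqx
  rw [hkx] at hx
  have hstep : Measurable fun u : F.T ↦ k (F.f x u) := hkm.comp (F.measurable_step_right x)
  have h2 := ae_eq_of_ae_le_of_lintegral_le (μ := F.ν) (f := fun u : F.T ↦ k (F.f x u))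
    (g := fun _ ↦ q) (Eventually.of_forall fun u ↦ min_le_right _ _) (by rw [hx]; exact hq)
    aemeasurable_const (by rw [hx]; simp)
  filter_upwards [h2] with u hu
  exact min_eq_right_iff.1 hu

/-- No mass leaves `B`, so one step yields at most the restriction of `μ` to `B`; conservation of
mass gives equality. -/
lemma push_restrict_eq {μ : Measure M} [IsProbabilityMeasure μ] (hμ : F.push μ = μ) {B : Set M}
    (hB : MeasurableSet B) (hinv : ∀ᵐ x ∂μ, x ∈ B → ∀ᵐ u : F.T ∂F.ν, F.f x u ∈ B) :
    F.push (μ.restrict B) = μ.restrict B := by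
  refine F.push_eq_of_le ?_
  have h0 : F.push (μ.restrict B) Bᶜ = 0 := by
    rw [F.push_apply _ hB.compl]
    have hm : Measurable fun x ↦ F.ν {u : F.T | F.f x u ∈ Bᶜ} :=
      measurable_measure_prodMk_left (F.measurable_step hB.compl)
    exact (lintegral_eq_zero_iff hm).2 ((ae_restrict_iff' hB).2 hinv)
  calc F.push (μ.restrict B) = (F.push (μ.restrict B)).restrict B :=
        (Measure.restrict_eq_self_of_ae_mem h0).symm
    _ ≤ (F.push μ).restrict B :=
        Measure.restrict_mono le_rfl (F.push_mono Measure.restrict_le_self)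
    _ = μ.restrict B := by rw [hμ]

lemma measure_compl_eq_zero_of_unique {μ : Measure M} [IsProbabilityMeasure μ]
    (hμ : F.push μ = μ)
    (huniq : ∀ μ' : Measure M, IsProbabilityMeasure μ' → F.push μ' = μ' → μ' ≪ μ → μ' = μ)
    {B : Set M} (hB : MeasurableSet B)
    (hinv : ∀ᵐ x ∂μ, x ∈ B → ∀ᵐ u : F.T ∂F.ν, F.f x u ∈ B) (h0 : μ B ≠ 0) : μ Bᶜ = 0 := by
  have hres := F.push_restrict_eq hμ hB hinv
  have hp : IsProbabilityMeasure ((μ B)⁻¹ • μ.restrict B) := ⟨by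
    rw [Measure.smul_apply, Measure.restrict_apply_univ, smul_eq_mul,
      ENNReal.inv_mul_cancel h0 (measure_ne_top _ _)]⟩
  have := huniq ((μ B)⁻¹ • μ.restrict B) hp (by rw [F.push_smul, hres])
    (Measure.smul_absolutelyContinuous.trans Measure.absolutelyContinuous_restrict)
  rw [← this, Measure.smul_apply, Measure.restrict_apply hB.compl, compl_inter_self, measure_empty,
    smul_zero]

/-- A superlevel set above the mean is invariant, hence null or full, and full would contradict the
mean. A function almost everywhere at most its mean equals it. -/
lemma ae_fiberProb_eq {μ : Measure M} [IsProbabilityMeasure μ] (hμ : F.push μ = μ)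
    (huniq : ∀ μ' : Measure M, IsProbabilityMeasure μ' → F.push μ' = μ' → μ' ≪ μ → μ' = μ)
    {A : Set (M × F.Δ)} (hA : MeasurableSet A) (hS : F.S ⁻¹' A = A) :
    ∀ᵐ x ∂μ, F.fiberProb A x = (μ.prod F.νInf) A := by
  set h := F.fiberProb A
  have hm : Measurable h := F.measurable_fiberProb hA
  have hint : ∫⁻ x, h x ∂μ = (μ.prod F.νInf) A := (Measure.prod_apply hA).symm
  set c := (μ.prod F.νInf) A
  have hc : c ≠ ⊤ := measure_ne_top _ _
  have hlev : ∀ q : ℝ≥0, c < q → ∀ᵐ x ∂μ, h x < q := by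
    intro q hq
    have hB : MeasurableSet {x | (q : ℝ≥0∞) ≤ h x} := measurableSet_le measurable_const hm
    have hinv := F.ae_step_mem_superlevel hμ hm (F.fiberProb_eq_lintegral hA hS)
      (q := q) ENNReal.coe_ne_top
    by_cases h0 : μ {x | (q : ℝ≥0∞) ≤ h x} = 0
    · simpa [ae_iff] using h0
    · have h1 := F.measure_compl_eq_zero_of_unique hμ huniq hB hinv h0
      refine absurd ?_ (not_le.2 hq)
      calc (q : ℝ≥0∞) = ∫⁻ _, q ∂μ := by simp
        _ ≤ ∫⁻ x, h x ∂μ := lintegral_mono_ae h1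
        _ = c := hint
  have hle : h ≤ᵐ[μ] fun _ ↦ c := by
    have : ∀ᵐ x ∂μ, ∀ q : ℚ, c < (Real.toNNReal q : ℝ≥0∞) → h x < (Real.toNNReal q : ℝ≥0∞) := by
      refine ae_all_iff.2 fun q ↦ ?_
      by_cases hq : c < (Real.toNNReal q : ℝ≥0∞)
      · filter_upwards [hlev _ hq] with x hx _ using hx
      · exact Eventually.of_forall fun x h ↦ absurd h hq
    filter_upwards [this] with x hx
    by_contra hcx
    obtain ⟨q, -, hq1, hq2⟩ := ENNReal.lt_iff_exists_rat_btwn.1 (not_le.1 hcx)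
    exact lt_asymm hq2 (hx q hq1)
  exact ae_eq_of_ae_le_of_lintegral_le hle (by rw [hint]; exact hc) aemeasurable_const
    (by rw [hint]; simp)

/-- From the core, the conditional probability stays `c` along almost every chain, so the fiber of
`A` is independent of every event depending on the first `k` parameters. -/
lemma νInf_fiber_inter {A : Set (M × F.Δ)} (hA : MeasurableSet A) (hS : F.S ⁻¹' A = A)
    {c : ℝ≥0∞} (hc : c ≠ ⊤) {x : M} (hx : x ∈ F.core {y | F.fiberProb A y = c}) (k : ℕ)
    {C : Set F.Δ} (hC : MeasurableSet C)
    (hk : ∀ t t' : F.Δ, (∀ i < k, t i = t' i) → t ∈ C → t' ∈ C) :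
    F.νInf ({t | (x, t) ∈ A} ∩ C) = c * F.νInf C := by
  have hN : MeasurableSet {y | F.fiberProb A y = c} :=
    F.measurable_fiberProb hA (measurableSet_singleton c)
  induction k generalizing x C with
  | zero =>
    rcases C.eq_empty_or_nonempty with rfl | ⟨t, ht⟩
    · simp
    · have : C = univ := eq_univ_of_forall fun t' ↦ hk t t' (by simp) ht
      rw [this, inter_univ, measure_univ, mul_one]
      exact F.core_subset _ hx
  | succ k ih =>
    have hAx : MeasurableSet {t | (x, t) ∈ A} := measurable_prodMk_left hA
    rw [F.νInf_apply (hAx.inter hC), F.νInf_apply hC, ← lintegral_const_mul' _ _ hc]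
    refine lintegral_congr_ae ?_
    filter_upwards [F.ae_step_mem_core hN hx] with u hu
    have hCu : MeasurableSet {t | F.cons (u, t) ∈ C} :=
      (F.measurable_cons.comp measurable_prodMk_left) hC
    have := ih hu hCu fun t t' htt' ht ↦ hk _ _ (fun i hi ↦ by
      cases i with
      | zero => rfl
      | succ i => exact htt' i (by omega)) ht
    rw [← this]
    congr 1
    ext t
    exact and_congr_left fun _ ↦ F.mem_cons_iff hS x u t

/-- Uniqueness of the stationary measure implies ergodicity. -/
lemma ergodic_of_unique {μ : Measure M} [IsProbabilityMeasure μ] (hμ : F.push μ = μ)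
    (huniq : ∀ μ' : Measure M, IsProbabilityMeasure μ' → F.push μ' = μ' → μ' ≪ μ → μ' = μ) :
    Ergodic F.S (μ.prod F.νInf) := by
  refine ⟨(F.isStationary_iff.2 ⟨inferInstance, hμ⟩).measurePreserving, ⟨fun {A} hA hS ↦ ?_⟩⟩
  rw [eventuallyConst_set']
  set c := (μ.prod F.νInf) A 
  by_cases hc0 : c = 0
  · exact Or.inl (ae_eq_empty.2 hc0)
  have hc : c ≠ ⊤ := measure_ne_top _ _
  refine Or.inr (ae_eq_univ.2 ((prob_compl_eq_zero_iff hA).2 ?_))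
  have hN : MeasurableSet {y | F.fiberProb A y = c} :=
    F.measurable_fiberProb hA (measurableSet_singleton c)
  have hcore := F.measure_compl_core hμ hN (F.ae_fiberProb_eq hμ huniq hA hS)
  obtain ⟨x, hx⟩ : ∃ x, x ∈ F.core {y | F.fiberProb A y = c} :=
    Eventually.exists (f := ae μ) hcore
  have hAx : MeasurableSet {t | (x, t) ∈ A} := measurable_prodMk_left hA
  -- Zero-one law: conditioning on the fiber changes no cylinder probability, so it does not change
  -- `νInf`, and the complement of the fiber is null.
  have hnorm : c⁻¹ • F.νInf.restrict {t | (x, t) ∈ A} = F.νInf := by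
    refine Measure.eq_infinitePi _ fun s B hB ↦ ?_
    have hpi : MeasurableSet (Set.pi (s : Set ℕ) B) := .pi s.countable_toSet fun i _ ↦ hB i
    rw [Measure.smul_apply, Measure.restrict_apply hpi, inter_comm,
      F.νInf_fiber_inter hA hS hc hx (s.sup id + 1) hpi, smul_eq_mul, ← mul_assoc,
      ENNReal.inv_mul_cancel hc0 hc, one_mul, νInf, Measure.infinitePi_pi _ fun i _ ↦ hB i]
    intro t t' htt' ht i hi
    rw [← htt' i (Nat.lt_succ_of_le (Finset.le_sup (f := id) hi))]
    exact ht i hi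
  have h1 : F.νInf {t | (x, t) ∈ A}ᶜ = 0 := by
    rw [← hnorm, Measure.smul_apply, Measure.restrict_apply hAx.compl, compl_inter_self,
      measure_empty, smul_zero]
  have h2 : F.fiberProb A x = c := F.core_subset _ hx
  change c = 1
  rw [← h2]
  exact (prob_compl_eq_zero_iff hAx).1 h1

end Ergodicity

end RandomPerturbation.ParametricNoise

end

/-! ### Assembly of the proposition -/

open RandomPerturbation in
theorem mainTheorem3 {d n : ℕ} (hn : 1 ≤ n) {M : Type*} [MetricSpace M] [CompactSpace M]
    [ChartedSpace (Euc d) M] [IsManifold 𝓘(ℝ, Euc d) ∞ M] [MeasurableSpace M] [BorelSpace M]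
    (gDist gVol : RiemMetric d M) (hdist : IsRiemannianDistance gDist)
    (m : Measure M) (hm : IsNormalizedRiemannianVolume gVol m)
    (F : ParametricNoise d n M) (K : ℕ) (ξ₀ : ℝ) (hξ₀ : 0 < ξ₀)
    (hA : F.ConditionA K ξ₀) (hB : F.ConditionB m K)
    (D : F.SInvariantDomain) (hD : D.IsMinimal) :
    ∃ μ : Measure M,
      (F.IsPhysical m μ ∧ μ ≪ m ∧ μ.support ⊆ D.closed) ∧
      (∀ μ' : Measure M, F.IsPhysical m μ' ∧ μ' ≪ m ∧ μ'.support ⊆ D.closed → μ' = μ) ∧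
      D.closed ⊆ F.basin μ := by
  have hcl := ParametricNoise.isClosed_closed D
  have hne : D.closed.Nonempty :=
    ((D.nonempty ⟨0, D.r_pos⟩).mono subset_closure).mono (subset_iUnion_of_subset _ subset_rfl)
  have hinv : ∀ x ∈ D.closed, ∀ u : F.T, F.f x u ∈ D.closed :=
    fun x hx u ↦ ParametricNoise.step_mem_closed D hx u
  obtain ⟨μ, hμp, hμ, hμc⟩ := F.exists_push_eq hcl hne hinv
  have huniq : ∀ μ' : Measure M, IsProbabilityMeasure μ' → F.push μ' = μ' →
      μ' D.closedᶜ = 0 → μ' = μ :=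
    fun μ' _ h1 h2 ↦ F.eq_of_push_eq hm hξ₀ hA hB hD h1 hμ h2 hμc
  have hbasin : D.closed ⊆ F.basin μ := F.subset_basin_of_unique hcl hinv huniq
  have hac : μ ≪ m := F.absolutelyContinuous_of_push_eq hB hμ
  have hstat := F.isStationary_iff.2 ⟨hμp, hμ⟩
  have herg : Ergodic F.S (μ.prod F.νInf) :=
    F.ergodic_of_unique hμ fun μ' hp h1 h2 ↦ huniq μ' hp h1 (h2 hμc)
  have hpos : 0 < m (F.basin μ) := by
    refine pos_iff_ne_zero.2 fun h0 ↦ ?_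
    -- The basin contains the closure, which has full `μ`-measure, and `μ ≪ m`.
    have h1 : μ D.closed = 0 := hac (measure_mono_null hbasin h0)
    exact one_ne_zero ((prob_compl_eq_zero_iff hcl.measurableSet).1 hμc ▸ h1)
  refine ⟨μ, ⟨⟨⟨hstat, herg⟩, hpos⟩, hac, Measure.support_subset_of_isClosed hcl hμc⟩, ?_, hbasin⟩
  rintro μ' ⟨hphys, -, hsup⟩
  obtain ⟨hp, hpush⟩ := F.isStationary_iff.1 hphys.toIsStationary
  exact huniq μ' hp hpush
    (measure_mono_null (compl_subset_compl.2 hsup) Measure.measure_compl_support)
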